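/- Oriented links are non-empty and are given by oriented link diagrams up to planar isotopy and the Reidemeister moves; a knot is a link with one component, and $\mathrm{O}$ denotes the unknot. For oriented knots $K_1,K_2$ let $K_1\# K_2$ be their (orientation-respecting) connected sum; a knot $K$ is prime if $K\neq \mathrm{O}$ and $K=K_1\#K_2$ implies $K_1=\mathrm{O}$ or $K_2=\mathrm{O}$. The Alexander--Conway polynomial $\nabla$ is the map from oriented links to $\mathbb{Z}[z]$ determined by the skein relations $$\nabla_{\mathrm{O}}(z)=1,\qquad \nabla_{L_+}(z)=\nabla_{L_-}(z)+z\,\nabla_{L_0}(z),$$ where $L_+,L_-,L_0$ have diagrams that agree except near one point, at which they show, respectively, a positive crossing, a negative crossing, and the two strands running side by side without a crossing, in the direction of their orientations. There is exactly one such map $\nabla$. Write $\nabla_K(z)_2$ for the coefficient of $z^2$ in $\nabla_K(z)$. Then: 1. If each of the knots $K_1,K_2$ is prime or the unknot, then $$\nabla_{K_1\#K_2}(z)_2=\nabla_{K_1}(z)_2+\nabla_{K_2}(z)_2 .$$ 2. More generally, if $n\ge 1$ and each of the knots $K_1,\dots,K_n$ is prime or the unknot, then $$\nabla_{K_1\#K_2\#\cdots\#K_n}(z)_2=\sum_{i=1}^n\nabla_{K_i}(z)_2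 .$$ -/

import Mathlib

/-!
Oriented links are given by oriented link diagrams in the plane, up to planar isotopy and the
Reidemeister moves. A diagram is drawn in generic position with respect to the height function and
recorded slice by slice, from bottom to top: every horizontal slice contains exactly one event,
which is a local minimum, a local maximum or a crossing, and all other strands are vertical.
-/

namespace KnotTheory

/-- The strands met by a horizontal line, from left to right: `true` is a strand that is oriented
upwards, `false` a strand that is oriented downwards. -/
abbrev Strands : Type := List Bool

/-- The events of a slice.
* `cup x` is a local minimum; its left end has orientation `x`, its right end the opposite one.
* `cap x` is a local maximum; its left end has orientation `x`, its right end the opposite one.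
* `cross p x y` is a crossing; `x` is the orientation of the strand that joins bottom left to top
  right, `y` that of the strand that joins bottom right to top left. The strand from bottom left to
  top right is the upper one (nearer to the reader) if `p = true`, and the lower one if
  `p = false`. -/
inductive Event : Type
  | cup (x : Bool) : Event
  | cap (x : Bool) : Event
  | cross (p x y : Bool) : Event

/-- The strands that enter an event from below. -/
def Event.src : Event → Strands
  | .cup _ => []
  | .cap x => [x, !x]
  | .cross _ x y => [x, y]

/-- The strands that leave an event at the top. -/
def Event.tgt : Event → Strands
  | .cup x => [x, !x]
  | .cap _ => []
  | .cross _ x y => [y, x]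

/-- A slice of a diagram: one event with vertical strands to its left and to its right. -/
structure Slice : Type where
  left : Strands
  event : Event
  right : Strands

/-- The strands at the bottom of a slice. -/
def Slice.src (s : Slice) : Strands := s.left ++ s.event.src ++ s.right

/-- The strands at the top of a slice. -/
def Slice.tgt (s : Slice) : Strands := s.left ++ s.event.tgt ++ s.right

/-- Add vertical strands `l` on the left and `r` on the right of a slice. -/
def Slice.whisker (l r : Strands) (s : Slice) : Slice := ⟨l ++ s.left, s.event, s.right ++ r⟩

/-- Add vertical strands `l` on the left and `r` on the right of a stack of slices. -/
def whisker (l r : Strands) (D : List Slice) : List Slice := D.map (Slice.whisker l r)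

/-- The list of slices `D` (from bottom to top) fits together to an oriented tangle diagram with
strands `a` at the bottom and `b` at the top. -/
def IsTangle : Strands → List Slice → Strands → Prop
  | a, [], b => a = b
  | a, s :: D, b => a = s.src ∧ IsTangle s.tgt D b

/-- The local moves. The signs `x y z` are the orientations of the strands and are arbitrary, and so
is the type `p` of the crossings. -/
inductive LocalMove : List Slice → List Slice → Prop
  /-- Planar isotopy: two events that lie side by side exchange their heights. -/
  | interchange (g h : Event) (m : Strands) :
      LocalMove [⟨[], g, m ++ h.src⟩, ⟨g.tgt ++ m, h, []⟩]
        [⟨g.src ++ m, h, []⟩, ⟨[], g, m ++ h.tgt⟩]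
  /-- Planar isotopy: a maximum and a minimum on a strand cancel (maximum on the left). -/
  | zigzag_left (x : Bool) :
      LocalMove [⟨[x], .cup (!x), []⟩, ⟨[], .cap x, [x]⟩] []
  /-- Planar isotopy: a maximum and a minimum on a strand cancel (maximum on the right). -/
  | zigzag_right (x : Bool) :
      LocalMove [⟨[], .cup x, [x]⟩, ⟨[x], .cap (!x), []⟩] []
  /-- A strand passes over or under a maximum. -/
  | slide_cap (p x y : Bool) :
      LocalMove [⟨[], .cross p y x, [!x]⟩, ⟨[x], .cross p y (!x), []⟩, ⟨[], .cap x, [y]⟩]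
        [⟨[y], .cap x, []⟩]
  /-- A strand passes over or under a minimum. -/
  | slide_cup (p x y : Bool) :
      LocalMove [⟨[], .cup x, [y]⟩, ⟨[x], .cross p (!x) y, []⟩, ⟨[], .cross p x y, [!x]⟩]
        [⟨[y], .cup x, []⟩]
  /-- First Reidemeister move, at a maximum. -/
  | reidemeister_one_cap (p x : Bool) :
      LocalMove [⟨[], .cross p x (!x), []⟩, ⟨[], .cap (!x), []⟩] [⟨[], .cap x, []⟩]
  /-- First Reidemeister move, at a minimum. -/
  | reidemeister_one_cup (p x : Bool) :
      LocalMove [⟨[], .cup x, []⟩, ⟨[], .cross p x (!x), []⟩] [⟨[], .cup (!x), []⟩]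
  /-- Second Reidemeister move. -/
  | reidemeister_two (p x y : Bool) :
      LocalMove [⟨[], .cross p x y, []⟩, ⟨[], .cross (!p) y x, []⟩] []
  /-- Third Reidemeister move. -/
  | reidemeister_three (p x y z : Bool) :
      LocalMove [⟨[], .cross p x y, [z]⟩, ⟨[y], .cross p x z, []⟩, ⟨[], .cross p y z, [x]⟩]
        [⟨[x], .cross p y z, []⟩, ⟨[], .cross p x z, [y]⟩, ⟨[z], .cross p x y, []⟩]

/-- An oriented link diagram (of a non-empty link). -/
structure LinkDiagram : Type where
  slices : List Slice
  isTangle : IsTangle [] slices []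
  ne_nil : slices ≠ []

/-- `D'` arises from `D` by one local move, applied somewhere in the diagram. -/
def LinkDiagram.Step (D D' : LinkDiagram) : Prop :=
  ∃ (A B M M' : List Slice) (l r : Strands), LocalMove M M' ∧
    D.slices = A ++ whisker l r M ++ B ∧ D'.slices = A ++ whisker l r M' ++ B

/-- Oriented (non-empty) links up to isotopy: oriented link diagrams up to the equivalence relation
that is generated by planar isotopy and the Reidemeister moves. -/
def Link : Type := Quot LinkDiagram.Step

/-- The link that is presented by a diagram. -/
def LinkDiagram.toLink (D : LinkDiagram) : Link := Quot.mk _ D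

/-! ### Knots -/

/-- `(k, i)` stands for the `i`-th strand, counted from the left, on the horizontal line below the
`k`-th slice. -/
def IsPoint (D : List Slice) (P : ℕ × ℕ) : Prop :=
  ∃ s, D[P.1]? = some s ∧ P.2 < s.src.length

/-- The two points are the ends of an arc of the diagram inside one slice. -/
inductive Joined (D : List Slice) : ℕ × ℕ → ℕ × ℕ → Prop
  | left (k : ℕ) (s : Slice) (i : ℕ) : D[k]? = some s → i < s.left.length →
      Joined D (k, i) (k + 1, i)
  | right (k : ℕ) (s : Slice) (i : ℕ) : D[k]? = some s → i < s.right.length →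
      Joined D (k, s.left.length + s.event.src.length + i)
        (k + 1, s.left.length + s.event.tgt.length + i)
  | cup (k : ℕ) (l r : Strands) (x : Bool) : D[k]? = some ⟨l, .cup x, r⟩ →
      Joined D (k + 1, l.length) (k + 1, l.length + 1)
  | cap (k : ℕ) (l r : Strands) (x : Bool) : D[k]? = some ⟨l, .cap x, r⟩ →
      Joined D (k, l.length) (k, l.length + 1)
  | cross_right (k : ℕ) (l r : Strands) (p x y : Bool) : D[k]? = some ⟨l, .cross p x y, r⟩ →
      Joined D (k, l.length) (k + 1, l.length + 1)
  | cross_left (k : ℕ) (l r : Strands) (p x y : Bool) : D[k]? = some ⟨l, .cross p x y, r⟩ →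
      Joined D (k, l.length + 1) (k + 1, l.length)

/-- A knot diagram is a link diagram with a single component: following the curve, one gets from
any point of it to any other one. -/
def LinkDiagram.IsKnotDiagram (D : LinkDiagram) : Prop :=
  ∀ P Q, IsPoint D.slices P → IsPoint D.slices Q → Relation.EqvGen (Joined D.slices) P Q

/-- An oriented knot: an oriented link that is presented by a knot diagram. -/
def Knot : Type := {L : Link // ∃ D : LinkDiagram, D.IsKnotDiagram ∧ D.toLink = L}

/-- A round circle, without crossings. -/
def unknotDiagram : LinkDiagram where
  slices := [⟨[], .cup true, []⟩, ⟨[], .cap true, []⟩]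
  isTangle := ⟨rfl, rfl, rfl⟩
  ne_nil := List.cons_ne_nil _ _

theorem unknotDiagram_isKnotDiagram : unknotDiagram.IsKnotDiagram := by
  have key : ∀ P, IsPoint unknotDiagram.slices P →
      Relation.EqvGen (Joined unknotDiagram.slices) (1, 0) P := by
    rintro ⟨k, i⟩ ⟨s, hs, hi⟩
    match k, hs with
    | 0, hs =>
      obtain rfl : (⟨[], .cup true, []⟩ : Slice) = s := Option.some.inj hs
      exact absurd hi (Nat.not_lt_zero _)
    | 1, hs =>
      obtain rfl : (⟨[], .cap true, []⟩ : Slice) = s := Option.some.inj hs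
      have hi2 : i < 2 := hi
      match i, hi2 with
      | 0, _ => exact .refl _
      | 1, _ => exact .rel _ _ (Joined.cap 1 [] [] true rfl)
    | _ + 2, hs => exact absurd hs (by simp [unknotDiagram])
  exact fun P Q hP hQ => ((key P hP).symm).trans _ _ _ (key Q hQ)

/-- The unknot. -/
def Knot.unknot : Knot := ⟨unknotDiagram.toLink, unknotDiagram, unknotDiagram_isKnotDiagram, rfl⟩

/-! ### Connected sums and prime knots -/

/-- A diagram with one upward end at the bottom and one at the top (a knot diagram that has been
cut open at one point). -/
def LongDiagram : Type := {T : List Slice // IsTangle [true] T [true]}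

theorem IsTangle.append {a b c : Strands} {S T : List Slice} (hS : IsTangle a S b)
    (hT : IsTangle b T c) : IsTangle a (S ++ T) c := by
  induction S generalizing a with
  | nil => cases hS; exact hT
  | cons s S ih => exact ⟨hS.1, ih hS.2⟩

theorem IsTangle.whisker {a b : Strands} {T : List Slice} (l r : Strands) (h : IsTangle a T b) :
    IsTangle (l ++ a ++ r) (whisker l r T) (l ++ b ++ r) := by
  induction T generalizing a with
  | nil => cases h; rfl
  | cons s T ih =>
    refine ⟨?_, ?_⟩
    · rw [h.1]; simp [Slice.src, Slice.whisker]
    · have key := ih h.2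
      simpa [Slice.tgt, Slice.whisker, KnotTheory.whisker] using key

/-- Put the second diagram on top of the first one. -/
def LongDiagram.comp (S T : LongDiagram) : LongDiagram := ⟨S.1 ++ T.1, S.2.append T.2⟩

/-- Join the two ends by an arc that runs on the right of the diagram. -/
def LongDiagram.closure (T : LongDiagram) : LinkDiagram where
  slices := [⟨[], .cup true, []⟩] ++ whisker [] [false] T.1 ++ [⟨[], .cap true, []⟩]
  isTangle := by
    have hcup : IsTangle [] [⟨[], .cup true, []⟩] [true, false] := ⟨rfl, rfl⟩
    have hcap : IsTangle [true, false] [⟨[], .cap true, []⟩] [] := ⟨rfl, rfl⟩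
    exact (hcup.append (T.2.whisker [] [false])).append hcap
  ne_nil := by simp

/-- `K` is the connected sum `K₁ # K₂`: the knots `K₁` and `K₂` are cut open, and the two pieces are
joined, respecting the orientations, to a single knot. -/
def IsConnectedSum (K₁ K₂ K : Knot) : Prop :=
  ∃ T₁ T₂ : LongDiagram, T₁.closure.toLink = K₁.1 ∧ T₂.closure.toLink = K₂.1 ∧
    (T₁.comp T₂).closure.toLink = K.1

/-- `K` is the iterated connected sum `K₁ # K₂ # ⋯ # Kₙ` of the list `[K₁, …, Kₙ]`, `n ≥ 1`. -/
inductive IsIteratedConnectedSum : List Knot → Knot → Prop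
  | single (K : Knot) : IsIteratedConnectedSum [K] K
  | snoc (Ks : List Knot) (K K' K'' : Knot) : IsIteratedConnectedSum Ks K →
      IsConnectedSum K K' K'' → IsIteratedConnectedSum (Ks ++ [K']) K''

/-- A knot is prime if it is non-trivial and is not the connected sum of two non-trivial knots. -/
def Knot.IsPrime (K : Knot) : Prop :=
  K ≠ Knot.unknot ∧
    ∀ K₁ K₂ : Knot, IsConnectedSum K₁ K₂ K → K₁ = Knot.unknot ∨ K₂ = Knot.unknot

/-! ### The Alexander-Conway polynomial -/

/-- The three diagrams agree except near one point, where two upward strands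
* cross, with the strand from bottom left to top right above the other one (`Dp`, that is `L₊`),
* cross, with the strand from bottom left to top right below the other one (`Dm`, that is `L₋`),
* run side by side without crossing (`D0`, that is `L₀`). -/
def IsSkeinTriple (Dp Dm D0 : LinkDiagram) : Prop :=
  ∃ (A B : List Slice) (l r : Strands),
    Dp.slices = A ++ [⟨l, .cross true true true, r⟩] ++ B ∧
    Dm.slices = A ++ [⟨l, .cross false true true, r⟩] ++ B ∧
    D0.slices = A ++ B

/-- The skein relations of the Alexander-Conway polynomial, in the variable `z = X`. -/
def IsConwayPolynomial (nabla : Link → Polynomial ℤ) : Prop :=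
  nabla Knot.unknot.1 = 1 ∧
    ∀ Dp Dm D0 : LinkDiagram, IsSkeinTriple Dp Dm D0 →
      nabla Dp.toLink = nabla Dm.toLink + Polynomial.X * nabla D0.toLink

end KnotTheory

open KnotTheory

/-! The constant and linear coefficients of `∇` on a knot are `1` and `0`, and `∇` is multiplicative
under connected sum. Comparing coefficients of `z²` in `(1 + a z² + ⋯)(1 + b z² + ⋯)` gives `a + b`,
and iterated sums follow by induction. The work lies in an explicit model of `∇`, which gives
existence, and in uniqueness, which transfers the properties of the model to every `∇`.

Existence: each strand carries a label, even (`false`) or odd (`true`), and minima, maxima and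
crossings act by the R-matrix calculus of the quantum supergroup of `gl(1|1)`, with `z = q - q⁻¹`.
The action `pull` respects all local moves, but the sum over all labels of a closed diagram
vanishes, because the superdimension of the strand is zero. Therefore `stateSum` fixes the label
`false` at the lowest minimum. Moves that change this minimum are harmless because the raising and
lowering operators commute with every tangle and kill the empty row (`stateSum_step`). The crossing
matrices satisfy the skein relation (`stateSum_skein`).

Uniqueness: by isotopy and the skein relation every tangle without lower ends reduces to a standard
one: circles, nested minima, a braid of upward strands, and a descending rearrangement of the ends
(`Span.of_isTangle`). The one hard step, adding a maximum, is the argument behind the Markov trace: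
in the Hecke algebra every braid reduces to braids that use the last generator at most once
(`Reduced.of_isBraid`). A closed diagram thus reduces to unlinks, on which the skein relation fixes
`∇` (`Link.skein_induction`, `IsConwayPolynomial.unique`).

The coefficients: a diagram with one lower and one upper end preserves charge, so it acts on the
label `false` by a scalar; scalars multiply under composition (`stateSum_comp`). At `q = 1` only
labellings constant along components survive, and a knot admits just the one prescribed at the cut,
of weight `1` (`Knot.coeff_zero`). Finally `∇` is even or odd in `z` according to a sign invariant,
so the linear coefficient of a knot vanishes (`Knot.coeff_one`). -/

namespace KnotTheory

/-! ### The `gl(1|1)` state sum and its invariance under the local moves. -/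

section StateSum

variable {R : Type*} [CommRing R] (q qi : R)

/-- The weight of a local minimum with label `b`. -/
def cupWeight (x b : Bool) : R :=
  match x, b with
  | true, false => q
  | true, true => -q
  | false, _ => 1

/-- The weight of a local maximum with label `b`. -/
def capWeight (x b : Bool) : R :=
  match x, b with
  | true, _ => 1
  | false, false => qi
  | false, true => -qi

/-- The weight of a crossing whose two strands keep their labels. -/
def passWeight (p x y b c : Bool) : R :=
  if b = c then
    match p == (x == y), b with
    | true, false => q
    | true, true => -qi
    | false, false => qi
    | false, true => -q
  else 1

/-- The weight of a crossing whose two strands are cut and reconnected without a crossing. -/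
def turnWeight (p x y b c : Bool) : R :=
  if b = xor p x then
    if x = y then if b = c then 0 else if p then q - qi else -(q - qi)
    else if b = c then if b then q - qi else -(q - qi) else 0
  else 0

/-- The action of an event on functions of the labels above it. -/
def eventOp (e : Event) (Φ : List Bool → R) : List Bool → R
  | σ => match e, σ with
    | .cup x, σ => cupWeight q x false * Φ (false :: false :: σ) +
        cupWeight q x true * Φ (true :: true :: σ)
    | .cap x, b :: c :: σ => if b = c then capWeight qi x b * Φ σ else 0
    | .cross p x y, b :: c :: σ => passWeight q qi p x y b c * Φ (c :: b :: σ) +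
        turnWeight q qi p x y b c *
          Φ ((if x = y then b else !b) :: (if x = y then c else !c) :: σ)
    | _, _ => 0

/-- Let an operator act to the right of the first `n` labels. -/
def shiftOp (Op : (List Bool → R) → List Bool → R) : ℕ → (List Bool → R) → List Bool → R
  | 0, Φ, σ => Op Φ σ
  | _ + 1, _, [] => 0
  | n + 1, Φ, b :: σ => shiftOp Op n (fun τ => Φ (b :: τ)) σ

/-- The action of a stack of slices on functions of the labels above it. -/
def pull : List Slice → (List Bool → R) → List Bool → R
  | [], Φ => Φ
  | s :: D, Φ => shiftOp (eventOp q qi s.event) s.left.length (pull D Φ)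

theorem pull_append (S T : List Slice) (Φ : List Bool → R) :
    pull q qi (S ++ T) Φ = pull q qi S (pull q qi T Φ) := by
  induction S with
  | nil => rfl
  | cons s S ih => simp [pull, ih]

theorem eventOp_linear (e : Event) (x y : R) (Φ Ψ : List Bool → R) (σ : List Bool) :
    eventOp q qi e (fun τ => x * Φ τ + y * Ψ τ) σ =
      x * eventOp q qi e Φ σ + y * eventOp q qi e Ψ σ := by
  rcases e with x | x | ⟨p, x, y⟩ <;> rcases σ with _ | ⟨b, _ | ⟨c, σ⟩⟩ <;>
    simp only [eventOp] <;> (try split_ifs) <;> ring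

theorem shiftOp_linear (e : Event) (n : ℕ) (x y : R) (Φ Ψ : List Bool → R) (σ : List Bool) :
    shiftOp (eventOp q qi e) n (fun τ => x * Φ τ + y * Ψ τ) σ =
      x * shiftOp (eventOp q qi e) n Φ σ + y * shiftOp (eventOp q qi e) n Ψ σ := by
  induction n generalizing Φ Ψ σ with
  | zero => exact eventOp_linear q qi e x y Φ Ψ σ
  | succ n ih =>
    rcases σ with _ | ⟨b, σ⟩
    · simp [shiftOp]
    · exact ih _ _ _

theorem shiftOp_zero (e : Event) (n : ℕ) (σ : List Bool) :
    shiftOp (eventOp q qi e) n (fun _ => 0) σ = 0 := by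
  simpa using shiftOp_linear q qi e n 0 0 (fun _ => 0) (fun _ => 0) σ

theorem shiftOp_add (Op : (List Bool → R) → List Bool → R) (n : ℕ) (Φ : List Bool → R)
    (σ τ : List Bool) :
    shiftOp Op (σ.length + n) Φ (σ ++ τ) = shiftOp Op n (fun ρ => Φ (σ ++ ρ)) τ := by
  induction σ generalizing Φ with
  | nil => simp
  | cons b σ ih =>
    rw [List.length_cons, show σ.length + 1 + n = σ.length + n + 1 by omega]
    exact ih _

/-- Strands on the left only fix a prefix of the labels; strands on the right need no treatment,
because `eventOp` leaves the tail of the row alone. -/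
theorem pull_whisker (l r : Strands) (T : List Slice) (Φ : List Bool → R) (σ τ : List Bool)
    (h : σ.length = l.length) :
    pull q qi (whisker l r T) Φ (σ ++ τ) = pull q qi T (fun ρ => Φ (σ ++ ρ)) τ := by
  induction T generalizing τ with
  | nil => rfl
  | cons s T ih =>
    simp only [whisker, List.map_cons, pull, Slice.whisker, List.length_append, ← h]
    rw [shiftOp_add]
    congr 1
    funext ρ
    exact ih ρ

/-! #### The labels carry a charge -/

/-- The charge of a labelled row of strands. -/
def charge : Strands → List Bool → ℤ
  | x :: a, b :: σ => (if b then if x then 1 else -1 else 0) + charge a σ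
  | _, _ => 0

/-- The labels fit to the strands and have charge `c`. -/
def HasCharge (a : Strands) (c : ℤ) (σ : List Bool) : Prop :=
  σ.length = a.length ∧ charge a σ = c

/-- Conservation of charge in dual form: every term with non-zero weight joins rows of equal charge,
so the values at charge `c` depend only on the values at charge `c` above the event. -/
theorem eventOp_congr (e : Event) (r : Strands) (c : ℤ) (Φ Ψ : List Bool → R)
    (h : ∀ σ, HasCharge (e.tgt ++ r) c σ → Φ σ = Ψ σ) (σ : List Bool)
    (hσ : HasCharge (e.src ++ r) c σ) : eventOp q qi e Φ σ = eventOp q qi e Ψ σ := by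
  rcases e with x | x | ⟨p, x, y⟩
  · simp only [eventOp]
    rw [h, h]
    · refine ⟨by simpa [Event.tgt, Event.src] using hσ.1, ?_⟩
      have := hσ.2
      simp only [Event.tgt, Event.src, List.nil_append, List.cons_append, charge] at this ⊢
      cases x <;> simpa using this
    · refine ⟨by simpa [Event.tgt, Event.src] using hσ.1, ?_⟩
      have := hσ.2
      simp only [Event.tgt, Event.src, List.nil_append, List.cons_append, charge] at this ⊢
      cases x <;> simpa using this
  · obtain ⟨h1, h2⟩ := hσ
    rcases σ with _ | ⟨b, _ | ⟨d, σ⟩⟩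
    · simp [eventOp]
    · simp [eventOp]
    · simp only [eventOp]
      by_cases hb : b = d
      · rw [if_pos hb, if_pos hb, h]
        refine ⟨by simpa [Event.tgt, Event.src] using h1, ?_⟩
        subst hb
        simp only [Event.tgt, Event.src, List.nil_append, List.cons_append, charge] at h2 ⊢
        cases x <;> cases b <;> simpa using h2
      · rw [if_neg hb, if_neg hb]
  · obtain ⟨h1, h2⟩ := hσ
    rcases σ with _ | ⟨b, _ | ⟨d, σ⟩⟩
    · simp [eventOp]
    · simp [eventOp]
    · simp only [eventOp]
      congr 1
      · rw [h]
        refine ⟨by simpa [Event.tgt, Event.src] using h1, ?_⟩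
        simp only [Event.tgt, Event.src, List.cons_append, charge] at h2 ⊢
        rw [← h2]; ring
      · by_cases ht : turnWeight q qi p x y b d = 0
        · rw [ht]; simp
        · rw [h]
          refine ⟨by simpa [Event.tgt, Event.src] using h1, ?_⟩
          simp only [Event.tgt, Event.src, List.cons_append, List.nil_append, charge] at h2 ⊢
          rw [← h2]
          revert ht
          cases x <;> cases y <;> cases b <;> cases d <;> simp [turnWeight]

theorem shiftOp_congr (e : Event) (l r : Strands) (c : ℤ) (Φ Ψ : List Bool → R)
    (h : ∀ σ, HasCharge (l ++ (e.tgt ++ r)) c σ → Φ σ = Ψ σ) (σ : List Bool)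
    (hσ : HasCharge (l ++ (e.src ++ r)) c σ) :
    shiftOp (eventOp q qi e) l.length Φ σ = shiftOp (eventOp q qi e) l.length Ψ σ := by
  induction l generalizing c Φ Ψ σ with
  | nil => exact eventOp_congr q qi e r c Φ Ψ h σ hσ
  | cons x l ih =>
    obtain ⟨h1, h2⟩ := hσ
    rcases σ with _ | ⟨b, σ⟩
    · rfl
    · refine ih (charge (l ++ (e.src ++ r)) σ) _ _ (fun τ hτ => h _ ⟨?_, ?_⟩) σ ⟨?_, rfl⟩
      · simpa using hτ.1
      · rw [← h2, List.cons_append, List.cons_append, charge, charge, hτ.2]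
      · simpa using h1

theorem pull_congr {a b : Strands} {T : List Slice} (hT : IsTangle a T b) (c : ℤ)
    (Φ Ψ : List Bool → R) (h : ∀ σ, HasCharge b c σ → Φ σ = Ψ σ) (σ : List Bool)
    (hσ : HasCharge a c σ) : pull q qi T Φ σ = pull q qi T Ψ σ := by
  induction T generalizing a σ with
  | nil => cases hT; exact h σ hσ
  | cons s T ih =>
    obtain ⟨rfl, hT⟩ := hT
    refine shiftOp_congr q qi s.event s.left s.right c _ _ (fun τ hτ => ih hT τ ?_) σ ?_
    · simpa [Slice.tgt] using hτ
    · simpa [Slice.src] using hσ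

theorem pull_congr_length {a b : Strands} {T : List Slice} (hT : IsTangle a T b)
    (Φ Ψ : List Bool → R) (h : ∀ σ, σ.length = b.length → Φ σ = Ψ σ) (σ : List Bool)
    (hσ : σ.length = a.length) : pull q qi T Φ σ = pull q qi T Ψ σ :=
  pull_congr q qi hT _ Φ Ψ (fun τ hτ => h τ hτ.1) σ ⟨hσ, rfl⟩

theorem pull_zero (T : List Slice) : pull q qi T (fun _ => 0) = fun _ => 0 := by
  induction T with
  | nil => rfl
  | cons s T ih => funext σ; rw [pull, ih, shiftOp_zero]

theorem pull_linear (A : List Slice) (x y : R)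
    (Φ Ψ : List Bool → R) :
    pull q qi A (fun τ => x * Φ τ + y * Ψ τ) =
      fun τ => x * pull q qi A Φ τ + y * pull q qi A Ψ τ := by
  induction A with
  | nil => rfl
  | cons s A ih => funext τ; simp only [pull, ih, shiftOp_linear]

/-! #### Invariance under the local moves -/

/-- The two operators touch disjoint sets of labels and each is linear, so they commute. No signs
appear, since every event preserves parity. -/
theorem pull_interchange (g h : Event) (m : Strands) (Φ : List Bool → R) (σ τ : List Bool)
    (hσ : σ.length = g.src.length) :
    pull q qi [⟨[], g, m ++ h.src⟩, ⟨g.tgt ++ m, h, []⟩] Φ (σ ++ τ) =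
      pull q qi [⟨g.src ++ m, h, []⟩, ⟨[], g, m ++ h.tgt⟩] Φ (σ ++ τ) := by
  rcases g with x | x | ⟨p, x, y⟩
  · obtain rfl : σ = [] := by simpa [Event.src] using hσ
    simp only [pull, List.length_nil, shiftOp, Event.tgt, Event.src, eventOp, List.nil_append,
      List.length_append, List.length_cons, shiftOp_linear]
    rw [show 0 + 1 + 1 + m.length = m.length + 1 + 1 by omega]
    rfl
  · obtain ⟨b, c, rfl⟩ : ∃ b c, σ = [b, c] := List.length_eq_two.1 hσ
    simp only [pull, List.length_nil, shiftOp, Event.tgt, Event.src, eventOp, List.nil_append,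
      List.length_cons, List.cons_append]
    split_ifs
    · have := shiftOp_linear q qi h m.length (capWeight qi x b) 0 Φ Φ τ
      simpa using this.symm
    · rw [shiftOp_zero]
  · obtain ⟨b, c, rfl⟩ : ∃ b c, σ = [b, c] := List.length_eq_two.1 hσ
    simp only [pull, List.length_nil, shiftOp, Event.tgt, Event.src, eventOp,
      List.length_cons, List.cons_append, List.nil_append, shiftOp_linear]

variable {q qi}

-- For each choice of orientations and labels both sides are linear combinations of values of `Φ`,
-- and the coefficients agree modulo `q * qi = 1`. The other moves on crossings are checked in the
-- same way.
set_option maxHeartbeats 2000000 in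
theorem pull_slide_cap (hq : q * qi = 1) (p x y : Bool) (Φ : List Bool → R) (b c d : Bool)
    (τ : List Bool) :
    pull q qi [⟨[], .cross p y x, [!x]⟩, ⟨[x], .cross p y (!x), []⟩, ⟨[], .cap x, [y]⟩] Φ
      (b :: c :: d :: τ) = pull q qi [⟨[y], .cap x, []⟩] Φ (b :: c :: d :: τ) := by
  cases p <;> cases x <;> cases y <;> cases b <;> cases c <;> cases d <;>
    simp only [pull, shiftOp, eventOp, cupWeight, capWeight, passWeight, turnWeight, List.length_nil,
      List.length_cons, Bool.not_true, Bool.not_false, Bool.xor_true, Bool.xor_false,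
      reduceCtorEq, if_true, if_false, beq_self_eq_true, Bool.true_beq, Bool.false_beq,
      zero_mul, mul_zero, add_zero, zero_add, one_mul] <;> grind

set_option maxHeartbeats 2000000 in
theorem pull_slide_cup (hq : q * qi = 1) (p x y : Bool) (Φ : List Bool → R) (b : Bool)
    (τ : List Bool) :
    pull q qi [⟨[], .cup x, [y]⟩, ⟨[x], .cross p (!x) y, []⟩, ⟨[], .cross p x y, [!x]⟩] Φ
      (b :: τ) = pull q qi [⟨[y], .cup x, []⟩] Φ (b :: τ) := by
  cases p <;> cases x <;> cases y <;> cases b <;>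
    simp only [pull, shiftOp, eventOp, cupWeight, capWeight, passWeight, turnWeight, List.length_nil,
      List.length_cons, Bool.not_true, Bool.not_false, Bool.xor_true, Bool.xor_false,
      reduceCtorEq, if_true, if_false, beq_self_eq_true, Bool.true_beq, Bool.false_beq,
      zero_mul, add_zero, zero_add, one_mul] <;> grind

set_option maxHeartbeats 2000000 in
theorem pull_reidemeister_two (hq : q * qi = 1) (p x y : Bool) (Φ : List Bool → R) (b c : Bool)
    (τ : List Bool) :
    pull q qi [⟨[], .cross p x y, []⟩, ⟨[], .cross (!p) y x, []⟩] Φ (b :: c :: τ) =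
      Φ (b :: c :: τ) := by
  cases p <;> cases x <;> cases y <;> cases b <;> cases c <;>
    simp only [pull, shiftOp, eventOp, cupWeight, capWeight, passWeight, turnWeight, List.length_nil,
      Bool.not_true, Bool.not_false, Bool.xor_true, Bool.xor_false,
      reduceCtorEq, if_true, if_false, beq_self_eq_true, Bool.true_beq, Bool.false_beq,
      zero_mul, add_zero, one_mul] <;> grind

set_option maxHeartbeats 2000000 in
theorem pull_reidemeister_three (hq : q * qi = 1) (p x y z : Bool) (Φ : List Bool → R)
    (b c d : Bool) (τ : List Bool) :
    pull q qi [⟨[], .cross p x y, [z]⟩, ⟨[y], .cross p x z, []⟩, ⟨[], .cross p y z, [x]⟩] Φ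
      (b :: c :: d :: τ) =
    pull q qi [⟨[x], .cross p y z, []⟩, ⟨[], .cross p x z, [y]⟩, ⟨[z], .cross p x y, []⟩] Φ
      (b :: c :: d :: τ) := by
  cases p <;> cases x <;> cases y <;> cases z <;> cases b <;> cases c <;> cases d <;>
    simp only [pull, shiftOp, eventOp, cupWeight, capWeight, passWeight, turnWeight, List.length_nil,
      List.length_cons, Bool.not_true, Bool.not_false, Bool.xor_true, Bool.xor_false,
      reduceCtorEq, if_true, if_false, beq_self_eq_true, Bool.true_beq, Bool.false_beq,
      zero_mul, add_zero, zero_add, one_mul] <;> grind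

theorem pull_localMove (hq : q * qi = 1) {M M' : List Slice} (hM : LocalMove M M') {a b : Strands}
    (ha : IsTangle a M b) (Φ : List Bool → R) (σ τ : List Bool) (hσ : σ.length = a.length) :
    pull q qi M Φ (σ ++ τ) = pull q qi M' Φ (σ ++ τ) := by
  cases hM with
  | interchange g h m =>
    obtain ⟨rfl, -⟩ := ha
    simp only [Slice.src, List.nil_append, List.length_append, ← Nat.add_assoc] at hσ
    rw [← List.take_append_drop g.src.length σ, List.append_assoc]
    exact pull_interchange q qi g h m Φ _ _ (by simp; omega)
  | zigzag_left x =>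
    obtain ⟨rfl, -⟩ := ha
    obtain ⟨b, rfl⟩ := List.length_eq_one_iff.1 hσ
    cases x <;> cases b <;> simp [pull, shiftOp, eventOp, cupWeight, capWeight] <;> grind
  | zigzag_right x =>
    obtain ⟨rfl, -⟩ := ha
    obtain ⟨b, rfl⟩ := List.length_eq_one_iff.1 hσ
    cases x <;> cases b <;> simp [pull, shiftOp, eventOp, cupWeight, capWeight] <;> grind
  | slide_cap p x y =>
    obtain ⟨rfl, -⟩ := ha
    obtain ⟨b, c, d, rfl⟩ := List.length_eq_three.1 hσ
    exact pull_slide_cap hq p x y Φ b c d τ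
  | slide_cup p x y =>
    obtain ⟨rfl, -⟩ := ha
    obtain ⟨b, rfl⟩ := List.length_eq_one_iff.1 hσ
    exact pull_slide_cup hq p x y Φ b τ
  | reidemeister_one_cap p x =>
    obtain ⟨rfl, -⟩ := ha
    obtain ⟨b, c, rfl⟩ := List.length_eq_two.1 hσ
    cases p <;> cases x <;> cases b <;> cases c <;>
      simp [pull, shiftOp, eventOp, capWeight, passWeight, turnWeight] <;> grind
  | reidemeister_one_cup p x =>
    obtain ⟨rfl, -⟩ := ha
    obtain rfl := List.length_eq_zero_iff.1 hσ
    cases p <;> cases x <;>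
      simp [pull, shiftOp, eventOp, cupWeight, passWeight, turnWeight] <;> grind
  | reidemeister_two p x y =>
    obtain ⟨rfl, -⟩ := ha
    obtain ⟨b, c, rfl⟩ := List.length_eq_two.1 hσ
    exact pull_reidemeister_two hq p x y Φ b c τ
  | reidemeister_three p x y z =>
    obtain ⟨rfl, -⟩ := ha
    obtain ⟨b, c, d, rfl⟩ := List.length_eq_three.1 hσ
    exact pull_reidemeister_three hq p x y z Φ b c d τ

end StateSum

/-! ### The supergroup symmetry, and independence of the place of the cut. -/

section Symmetry

variable {R : Type*} [CommRing R] (q qi : R)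

/-- The weight with which one strand is raised (`s = false`) or lowered (`s = true`). -/
def flipWeight (s x b : Bool) : R :=
  match x with
  | true => if b = s then 1 else 0
  | false => if b = s then 0 else if s then qi else -qi

/-- The factor that a strand contributes to the flips on its right. -/
def signWeight (x b : Bool) : R :=
  match x, b with
  | true, false => q
  | true, true => -q
  | false, false => qi
  | false, true => -qi

/-- The raising (`s = false`) and the lowering (`s = true`) operator of the quantum supergroup of
`gl(1|1)`. -/
def superAct (s : Bool) : Strands → (List Bool → R) → List Bool → R
  | x :: a, Φ, b :: σ => flipWeight qi s x b * Φ ((!b) :: σ) +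
      signWeight q qi x b * superAct s a (fun τ => Φ (b :: τ)) σ
  | _, _, _ => 0

theorem superAct_linear (s : Bool) (a : Strands) (x y : R) (Φ Ψ : List Bool → R)
    (σ : List Bool) :
    superAct q qi s a (fun τ => x * Φ τ + y * Ψ τ) σ =
      x * superAct q qi s a Φ σ + y * superAct q qi s a Ψ σ := by
  induction a generalizing Φ Ψ σ with
  | nil => simp [superAct]
  | cons z a ih =>
    rcases σ with _ | ⟨b, σ⟩
    · simp [superAct]
    · simp only [superAct, ih]; ring

theorem superAct_zero (s : Bool) (a : Strands) (σ : List Bool) :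
    superAct q qi s a (fun _ => 0) σ = 0 := by
  simpa using superAct_linear q qi s a 0 0 (fun _ => 0) (fun _ => 0) σ

theorem superAct_smul (s : Bool) (a : Strands) (x : R) (Φ : List Bool → R) (σ : List Bool) :
    superAct q qi s a (fun τ => x * Φ τ) σ = x * superAct q qi s a Φ σ := by
  simpa using superAct_linear q qi s a x 0 Φ Φ σ

variable {q qi}

-- Every event intertwines the actions of the odd generators on its source and its target. The
-- strands to the right enter only through linearity, so again a finite check remains.
set_option maxHeartbeats 1000000 in
theorem superAct_eventOp (hq : q * qi = 1) (s : Bool) (e : Event) (r : Strands)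
    (Φ : List Bool → R) (σ : List Bool) (hσ : σ.length = (e.src ++ r).length) :
    superAct q qi s (e.src ++ r) (eventOp q qi e Φ) σ =
      eventOp q qi e (superAct q qi s (e.tgt ++ r) Φ) σ := by
  rcases e with x | x | ⟨p, x, y⟩
  · have h : superAct q qi s r (eventOp q qi (.cup x) Φ) σ = _ :=
      superAct_linear q qi s r (cupWeight q x false) (cupWeight q x true)
        (fun τ => Φ (false :: false :: τ)) (fun τ => Φ (true :: true :: τ)) σ
    simp only [Event.src, Event.tgt, List.nil_append, List.cons_append]
    rw [h]
    simp only [eventOp, superAct]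
    cases x <;> cases s <;>
      simp only [flipWeight, signWeight, cupWeight, Bool.not_true, Bool.not_false,
        reduceCtorEq, if_true, if_false] <;> grind
  · obtain ⟨b, c, σ, rfl⟩ : ∃ b c ρ, σ = b :: c :: ρ := by
      rcases σ with _ | ⟨b, _ | ⟨c, σ⟩⟩
      · simp [Event.src] at hσ
      · simp [Event.src] at hσ
      · exact ⟨b, c, σ, rfl⟩
    have h := superAct_smul q qi s r (capWeight qi x b) Φ σ
    have h0 := superAct_zero q qi s r σ
    cases x <;> cases b <;> cases c <;> cases s <;>
      simp only [eventOp, Event.src, Event.tgt, List.nil_append, List.cons_append, superAct,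
        capWeight, flipWeight, signWeight, Bool.not_true, Bool.not_false,
        reduceCtorEq, if_true, if_false] at h ⊢ <;> simp only [h, h0] <;> grind
  · obtain ⟨b, c, σ, rfl⟩ : ∃ b c ρ, σ = b :: c :: ρ := by
      rcases σ with _ | ⟨b, _ | ⟨c, σ⟩⟩
      · simp [Event.src] at hσ
      · simp [Event.src] at hσ
      · exact ⟨b, c, σ, rfl⟩
    have h := superAct_linear q qi s r (passWeight q qi p x y b c) (turnWeight q qi p x y b c)
      (fun τ => Φ (c :: b :: τ))
      (fun τ => Φ ((if x = y then b else !b) :: (if x = y then c else !c) :: τ)) σ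
    simp only [eventOp, Event.src, Event.tgt, List.nil_append, List.cons_append, superAct, h]
    clear h hσ
    cases p <;> cases x <;> cases y <;> cases s <;> cases b <;> cases c <;>
      simp only [passWeight, turnWeight, flipWeight, signWeight, Bool.not_true, Bool.not_false,
        Bool.xor_true, Bool.xor_false, reduceCtorEq, if_true, if_false, beq_self_eq_true,
        Bool.true_beq, Bool.false_beq, zero_mul, add_zero, zero_add, one_mul] <;> grind

theorem superAct_shiftOp (hq : q * qi = 1) (s : Bool) (e : Event) (l r : Strands)
    (Φ : List Bool → R) (σ : List Bool) (hσ : σ.length = (l ++ (e.src ++ r)).length) :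
    superAct q qi s (l ++ (e.src ++ r)) (shiftOp (eventOp q qi e) l.length Φ) σ =
      shiftOp (eventOp q qi e) l.length (superAct q qi s (l ++ (e.tgt ++ r)) Φ) σ := by
  induction l generalizing Φ σ with
  | nil => exact superAct_eventOp hq s e r Φ σ hσ
  | cons x l ih =>
    rcases σ with _ | ⟨b, σ⟩
    · simp at hσ
    · have h := shiftOp_linear q qi e l.length (flipWeight qi s x b) (signWeight q qi x b)
        (fun τ => Φ ((!b) :: τ)) (superAct q qi s (l ++ (e.tgt ++ r)) fun τ => Φ (b :: τ)) σ
      simp only [List.cons_append, superAct, List.length_cons, shiftOp]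
      rw [h, ← ih _ _ (by simpa using hσ)]

theorem superAct_pull (hq : q * qi = 1) (s : Bool) {a b : Strands} {T : List Slice}
    (hT : IsTangle a T b) (Φ : List Bool → R) (σ : List Bool) (hσ : σ.length = a.length) :
    superAct q qi s a (pull q qi T Φ) σ = pull q qi T (superAct q qi s b Φ) σ := by
  induction T generalizing a σ with
  | nil => cases hT; rfl
  | cons t T ih =>
    obtain ⟨rfl, hT⟩ := hT
    rw [Slice.src, List.append_assoc] at hσ ⊢
    rw [pull, superAct_shiftOp hq s _ _ _ _ _ hσ, pull]
    refine shiftOp_congr q qi t.event t.left t.right (charge _ σ) _ _ (fun τ hτ => ?_) σ ⟨hσ, rfl⟩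
    have h := ih hT τ (by simpa [Slice.tgt] using hτ.1)
    rwa [Slice.tgt, List.append_assoc] at h

/-- The function that is `1` on the empty row of labels. -/
def emptyLabels (σ : List Bool) : R := if σ = [] then 1 else 0

/-- At the top of a diagram that closes up, the operators act on the empty row, that is, by zero.
The result is a supply of linear relations between values of `pull` below, from which different cuts
can be compared. -/
theorem superAct_pull_empty (hq : q * qi = 1) (s : Bool) {a : Strands} {T : List Slice}
    (hT : IsTangle a T []) (σ : List Bool) (hσ : σ.length = a.length) :
    superAct q qi s a (pull q qi T emptyLabels) σ = 0 := by
  rw [superAct_pull hq s hT _ σ hσ]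
  exact congrFun (pull_zero q qi T) σ

variable (q qi) in
/-- The state sum of a diagram that is cut open at its lowest minimum. -/
def stateSum : List Slice → R
  | ⟨_, .cup x, _⟩ :: D => (if x then 1 else q) * pull q qi D emptyLabels [false, false]
  | _ => 0

/-- Both sides cut at one of the two lowest minima and sum over the labels of the other; the
symmetry shows that the choice of the cut is irrelevant. -/
theorem stateSum_cup_cup (hq : q * qi = 1) (x y : Bool) {T : List Slice}
    (hT : IsTangle [x, !x, y, !y] T []) :
    stateSum q qi (⟨[], .cup x, []⟩ :: ⟨[x, !x], .cup y, []⟩ :: T) =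
      stateSum q qi (⟨[], .cup y, []⟩ :: ⟨[], .cup x, [y, !y]⟩ :: T) := by
  have h1 := fun s b c d e => superAct_pull_empty (q := q) (qi := qi) hq s hT [b, c, d, e] rfl
  -- The rows are chosen so that the first relation contains the values with labels `true, true` on
  -- the left minimum, the second those with `true, true` on the right one, and both contain the
  -- mixed value at `[!x, x, y, !y]`, which is then eliminated.
  have h2 := h1 false (!x) x false false
  have h3 := h1 true false false y (!y)
  clear h1
  simp only [stateSum, pull, List.length_nil, List.length_cons, shiftOp, eventOp]
  cases x <;> cases y <;>
    simp only [superAct, flipWeight, signWeight, cupWeight, Bool.not_true, Bool.not_false,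
      reduceCtorEq, if_true, if_false, mul_zero, add_zero] at h2 h3 ⊢ <;> grind

/-- Above the cut the crossing can turn `false, false` into `true, true`; the symmetry expresses the
value at `[true, true]` through that at `[false, false]`. -/
theorem stateSum_cup_cross (hq : q * qi = 1) (p x : Bool) {T : List Slice}
    (hT : IsTangle [!x, x] T []) :
    stateSum q qi (⟨[], .cup x, []⟩ :: ⟨[], .cross p x (!x), []⟩ :: T) =
      stateSum q qi (⟨[], .cup (!x), []⟩ :: T) := by
  have h1 := fun s b c => superAct_pull_empty (q := q) (qi := qi) hq s hT [b, c] rfl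
  have h2 := h1 false false true
  have h3 := h1 false true false
  clear h1
  simp only [stateSum, pull, List.length_nil, shiftOp, eventOp]
  cases x <;> cases p <;>
    simp only [superAct, flipWeight, signWeight, passWeight, turnWeight, Bool.not_true,
      Bool.not_false, Bool.xor_true, Bool.xor_false, beq_self_eq_true, Bool.true_beq,
      Bool.false_beq, reduceCtorEq, if_true, if_false, mul_zero, add_zero] at h2 h3 ⊢ <;> grind

end Symmetry

/-! ### Typing of stacks of slices -/

theorem isTangle_append_iff {a b : Strands} {S T : List Slice} :
    IsTangle a (S ++ T) b ↔ ∃ c, IsTangle a S c ∧ IsTangle c T b := by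
  induction S generalizing a with
  | nil => simp [IsTangle]
  | cons s S ih => simp [IsTangle, ih, and_assoc]

theorem IsTangle.target_unique {a b b' : Strands} {T : List Slice} (h : IsTangle a T b)
    (h' : IsTangle a T b') : b = b' := by
  induction T generalizing a with
  | nil => exact h.symm.trans h'
  | cons s T ih => exact ih h.2 h'.2

/-- The left side of a move is never empty, so its first slice determines the lower boundary, and
the right side has the same two boundaries. -/
theorem LocalMove.isTangle {M M' : List Slice} (h : LocalMove M M') :
    ∃ s M₁ b, M = s :: M₁ ∧ IsTangle s.src M b ∧ IsTangle s.src M' b := by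
  have key : ∀ (s : Slice) (M₁ : List Slice) (b : Strands), IsTangle s.tgt M₁ b →
      IsTangle s.src M' b → M = s :: M₁ →
      ∃ s M₁ b, M = s :: M₁ ∧ IsTangle s.src M b ∧ IsTangle s.src M' b := by
    rintro s M₁ b h1 h2 rfl
    exact ⟨s, M₁, b, rfl, ⟨rfl, h1⟩, h2⟩
  cases h with
  | interchange g h m =>
    refine key _ _ (g.tgt ++ m ++ h.tgt) ?_ ?_ rfl <;> simp [IsTangle, Slice.src, Slice.tgt]
  | zigzag_left x =>
    refine key _ _ [x] ?_ ?_ rfl <;>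
      simp [IsTangle, Slice.src, Slice.tgt, Event.src, Event.tgt]
  | zigzag_right x =>
    refine key _ _ [x] ?_ ?_ rfl <;>
      simp [IsTangle, Slice.src, Slice.tgt, Event.src, Event.tgt]
  | slide_cap p x y =>
    refine key _ _ [y] ?_ ?_ rfl <;>
      simp [IsTangle, Slice.src, Slice.tgt, Event.src, Event.tgt]
  | slide_cup p x y =>
    refine key _ _ [y, x, !x] ?_ ?_ rfl <;>
      simp [IsTangle, Slice.src, Slice.tgt, Event.src, Event.tgt]
  | reidemeister_one_cap p x =>
    refine key _ _ [] ?_ ?_ rfl <;>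
      simp [IsTangle, Slice.src, Slice.tgt, Event.src, Event.tgt]
  | reidemeister_one_cup p x =>
    refine key _ _ [!x, x] ?_ ?_ rfl <;>
      simp [IsTangle, Slice.src, Slice.tgt, Event.src, Event.tgt]
  | reidemeister_two p x y =>
    refine key _ _ [x, y] ?_ ?_ rfl <;>
      simp [IsTangle, Slice.src, Slice.tgt, Event.src, Event.tgt]
  | reidemeister_three p x y z =>
    refine key _ _ [z, y, x] ?_ ?_ rfl <;>
      simp [IsTangle, Slice.src, Slice.tgt, Event.src, Event.tgt]

theorem LocalMove.isTangle_whisker {M M' : List Slice} (h : LocalMove M M') {l r a b : Strands}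
    (hM : IsTangle a (whisker l r M) b) :
    ∃ a₀ b₀, a = l ++ a₀ ++ r ∧ b = l ++ b₀ ++ r ∧ IsTangle a₀ M b₀ ∧ IsTangle a₀ M' b₀ ∧
      IsTangle a (whisker l r M') b := by
  obtain ⟨s, M₁, b₀, rfl, h1, h2⟩ := h.isTangle
  have ha : a = l ++ s.src ++ r := by
    rw [hM.1]; simp [Slice.src, Slice.whisker]
  have hb : b = l ++ b₀ ++ r := by
    refine hM.target_unique ?_
    rw [ha]; exact h1.whisker l r
  refine ⟨_, _, ha, hb, h1, h2, ?_⟩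
  rw [ha, hb]; exact h2.whisker l r

theorem pull_move {R : Type*} [CommRing R] {q qi : R} (hq : q * qi = 1) {M M' : List Slice}
    (h : LocalMove M M') {l r a b : Strands} {A B : List Slice}
    (hT : IsTangle a (A ++ whisker l r M ++ B) b) (Φ : List Bool → R) (σ : List Bool)
    (hσ : σ.length = a.length) :
    pull q qi (A ++ whisker l r M ++ B) Φ σ = pull q qi (A ++ whisker l r M' ++ B) Φ σ := by
  obtain ⟨c, hc, -⟩ := isTangle_append_iff.1 hT
  obtain ⟨d, hA, hM⟩ := isTangle_append_iff.1 hc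
  obtain ⟨a₀, b₀, rfl, -, h1, -, -⟩ := h.isTangle_whisker hM
  simp only [pull_append]
  refine pull_congr_length q qi hA _ _ (fun τ hτ => ?_) σ hσ
  rw [List.length_append, List.length_append] at hτ
  rw [← List.take_append_drop l.length τ, pull_whisker _ _ _ _ _ _ _ _ (by simp; omega),
    pull_whisker _ _ _ _ _ _ _ _ (by simp; omega),
    ← List.take_append_drop a₀.length (List.drop l.length τ)]
  exact pull_localMove hq h h1 _ _ _ (by simp; omega)

/-- The first slice of a non-empty diagram is a minimum. -/
theorem exists_eq_cup {s : Slice} (hs : [] = s.src) : ∃ x, s = ⟨[], .cup x, []⟩ := by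
  obtain ⟨l, e, r⟩ := s
  simp only [Slice.src] at hs
  have h := List.append_eq_nil_iff.1 hs.symm
  have h' := List.append_eq_nil_iff.1 h.1
  obtain ⟨rfl, he⟩ := h'
  obtain rfl := h.2
  cases e with
  | cup x => exact ⟨x, rfl⟩
  | cap x => simp [Event.src] at he
  | cross p x y => simp [Event.src] at he

/-- If the move happens above the lowest minimum, `pull` is already invariant. Otherwise the move
starts from an empty row, which leaves only the interchange of two minima and the first Reidemeister
move at a minimum. -/
theorem stateSum_step {R : Type*} [CommRing R] {q qi : R} (hq : q * qi = 1)
    {D D' : LinkDiagram} (h : D.Step D') :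
    stateSum q qi D.slices = stateSum q qi D'.slices := by
  obtain ⟨A, B, M, M', l, r, hM, hD, hD'⟩ := h
  have hT := D.isTangle
  rw [hD] at hT
  rw [hD, hD']
  rcases A with _ | ⟨s, A⟩
  · simp only [List.nil_append] at hT ⊢
    obtain ⟨c, hc, hB⟩ := isTangle_append_iff.1 hT
    obtain ⟨a₀, b₀, h0, rfl, h1, -, -⟩ := hM.isTangle_whisker hc
    have h2 := List.append_eq_nil_iff.1 h0.symm
    obtain ⟨rfl, rfl⟩ := List.append_eq_nil_iff.1 h2.1
    obtain rfl := h2.2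
    cases hM with
    | interchange g h m =>
      obtain ⟨x, hx⟩ := exists_eq_cup h1.1
      simp only [Slice.mk.injEq, List.append_eq_nil_iff, true_and] at hx
      obtain ⟨rfl, rfl, hh⟩ := hx
      rcases h with y | y | ⟨p, y, z⟩
      · obtain ⟨-, -, h3⟩ := hT
        refine stateSum_cup_cup hq x y ?_
        simpa [Slice.tgt, Event.tgt, Slice.whisker] using h3
      · simp [Event.src] at hh
      · simp [Event.src] at hh
    | zigzag_left x => simp [IsTangle, Slice.src, Event.src] at h1
    | zigzag_right x => simp [IsTangle, Slice.src, Event.src] at h1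
    | slide_cap p x y => simp [IsTangle, Slice.src, Event.src] at h1
    | slide_cup p x y => simp [IsTangle, Slice.src, Event.src] at h1
    | reidemeister_one_cap p x => simp [IsTangle, Slice.src, Event.src] at h1
    | reidemeister_one_cup p x =>
      obtain ⟨-, -, h3⟩ := hT
      refine stateSum_cup_cross hq p x ?_
      simpa [Slice.tgt, Event.tgt, Slice.whisker] using h3
    | reidemeister_two p x y => simp [IsTangle, Slice.src, Event.src] at h1
    | reidemeister_three p x y z => simp [IsTangle, Slice.src, Event.src] at h1
  · obtain ⟨x, rfl⟩ := exists_eq_cup hT.1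
    simp only [List.cons_append, stateSum]
    rw [pull_move hq hM hT.2 _ _ (by simp [Slice.tgt, Event.tgt])]

/-! ### The Conway polynomial exists -/

open Polynomial in
/-- The ring `ℤ[z][q]` with `q² = 1 + zq`. -/
abbrev SkeinRing : Type := QuadraticAlgebra ℤ[X] 1 X

namespace SkeinRing

/-- The generator `q`. -/
noncomputable def q : SkeinRing := ⟨0, 1⟩

/-- The inverse of `q`. -/
noncomputable def qi : SkeinRing := ⟨-Polynomial.X, 1⟩

theorem q_mul_qi : q * qi = 1 := by
  apply QuadraticAlgebra.ext <;> simp [q, qi, QuadraticAlgebra.re_one, QuadraticAlgebra.im_one]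

theorem q_sub_qi : q - qi = algebraMap (Polynomial ℤ) SkeinRing Polynomial.X := by
  apply QuadraticAlgebra.ext <;> simp [q, qi, QuadraticAlgebra.algebraMap_eq]

end SkeinRing

/-- The state sum of a link. -/
noncomputable def Link.stateSum (L : Link) : SkeinRing :=
  Quot.lift (fun D : LinkDiagram => KnotTheory.stateSum SkeinRing.q SkeinRing.qi D.slices)
    (fun _ _ h => stateSum_step SkeinRing.q_mul_qi h) L

/-- The quadratic relation of the R-matrix: a positive crossing minus a negative one is `q - qi`
times the identity. -/
theorem shiftOp_cross_sub {R : Type*} [CommRing R] (q qi : R) (n : ℕ) (Φ : List Bool → R)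
    (σ : List Bool) (hσ : n + 2 ≤ σ.length) :
    shiftOp (eventOp q qi (.cross true true true)) n Φ σ =
      shiftOp (eventOp q qi (.cross false true true)) n Φ σ + (q - qi) * Φ σ := by
  induction n generalizing Φ σ with
  | zero =>
    rcases σ with _ | ⟨b, _ | ⟨c, σ⟩⟩
    · simp at hσ
    · simp at hσ
    · cases b <;> cases c <;> simp [shiftOp, eventOp, passWeight, turnWeight] <;> ring
  | succ n ih =>
    rcases σ with _ | ⟨b, σ⟩
    · simp at hσ
    · exact ih _ σ (by simpa using hσ)

theorem pull_skein {R : Type*} [CommRing R] (q qi : R) {a b : Strands} {l r : Strands}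
    {A B : List Slice} (hT : IsTangle a (A ++ [⟨l, .cross true true true, r⟩] ++ B) b)
    (Φ : List Bool → R) (σ : List Bool) (hσ : σ.length = a.length) :
    pull q qi (A ++ [⟨l, .cross true true true, r⟩] ++ B) Φ σ =
      pull q qi (A ++ [⟨l, .cross false true true, r⟩] ++ B) Φ σ +
        (q - qi) * pull q qi (A ++ B) Φ σ := by
  obtain ⟨c, hc, -⟩ := isTangle_append_iff.1 hT
  obtain ⟨d, hA, hM⟩ := isTangle_append_iff.1 hc
  obtain rfl := hM.1
  simp only [pull_append, pull]
  have hlin := fun Ψ Ψ' => congrFun (pull_linear q qi A 1 (q - qi) Ψ Ψ') σ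
  simp only [one_mul] at hlin
  rw [← hlin]
  refine pull_congr_length q qi hA _ _ (fun τ hτ => ?_) σ hσ
  refine shiftOp_cross_sub q qi _ _ τ ?_
  rw [hτ]; simp [Slice.src, Event.src]

theorem stateSum_skein {R : Type*} [CommRing R] (q qi : R) {Dp Dm D0 : LinkDiagram}
    (h : IsSkeinTriple Dp Dm D0) :
    stateSum q qi Dp.slices = stateSum q qi Dm.slices + (q - qi) * stateSum q qi D0.slices := by
  obtain ⟨A, B, l, r, hp, hm, h0⟩ := h
  have hT := Dp.isTangle
  rw [hp] at hT
  rw [hp, hm, h0]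
  rcases A with _ | ⟨s, A⟩
  · have h1 := hT.1
    simp [Slice.src, Event.src] at h1
  · obtain ⟨x, rfl⟩ := exists_eq_cup hT.1
    simp only [List.cons_append, stateSum]
    rw [pull_skein q qi (A := A) hT.2 _ _ (by simp [Slice.tgt, Event.tgt])]
    ring

theorem stateSum_unknot : Link.stateSum Knot.unknot.1 = 1 := by
  show KnotTheory.stateSum SkeinRing.q SkeinRing.qi unknotDiagram.slices = 1
  simp [unknotDiagram, stateSum, pull, shiftOp, eventOp, capWeight, emptyLabels]

/-- The projection `re` is `ℤ[X]`-linear and `q - qi` is the scalar `X`, so the skein relation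
survives the projection. -/
theorem exists_isConwayPolynomial :
    IsConwayPolynomial fun L => L.stateSum.re := by
  refine ⟨by simp [stateSum_unknot, QuadraticAlgebra.re_one], fun Dp Dm D0 h => ?_⟩
  have := stateSum_skein SkeinRing.q SkeinRing.qi h
  show (KnotTheory.stateSum SkeinRing.q SkeinRing.qi Dp.slices).re = (KnotTheory.stateSum SkeinRing.q SkeinRing.qi Dm.slices).re +
    Polynomial.X * (KnotTheory.stateSum SkeinRing.q SkeinRing.qi D0.slices).re
  rw [this, SkeinRing.q_sub_qi]
  simp
-- Isotopy calculus for tangles, and descending rearrangements of strands.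
section Calculus

attribute [local simp] IsTangle Slice.src Slice.tgt Event.src Event.tgt whisker Slice.whisker

/-! ### Isotopy of tangles -/

theorem whisker_append (l r : Strands) (S T : List Slice) :
    whisker l r (S ++ T) = whisker l r S ++ whisker l r T := List.map_append

theorem whisker_whisker (l r l' r' : Strands) (T : List Slice) :
    whisker l r (whisker l' r' T) = whisker (l ++ l') (r' ++ r) T := by
  simp [List.map_map, Function.comp_def]

@[local simp]
theorem sliceWhisker_comp (l r l' r' : Strands) :
    Slice.whisker l r ∘ Slice.whisker l' r' = Slice.whisker (l ++ l') (r' ++ r) := by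
  funext s; simp

/-- One local move on a tangle with strands `a` at the bottom. -/
def TangleStep (a : Strands) (S T : List Slice) : Prop :=
  ∃ (A B M M' : List Slice) (l r c : Strands), LocalMove M M' ∧
    IsTangle a (A ++ whisker l r M) c ∧ S = A ++ whisker l r M ++ B ∧ T = A ++ whisker l r M' ++ B

/-- Isotopy of tangles with strands `a` at the bottom. -/
def Eqv (a : Strands) : List Slice → List Slice → Prop := Relation.EqvGen (TangleStep a)

namespace Eqv

variable {a b c : Strands} {S T U A B : List Slice}

theorem refl (a : Strands) (S : List Slice) : Eqv a S S := Relation.EqvGen.refl S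

theorem symm (h : Eqv a S T) : Eqv a T S := Relation.EqvGen.symm _ _ h

theorem trans (h : Eqv a S T) (h' : Eqv a T U) : Eqv a S U := Relation.EqvGen.trans _ _ _ h h'

instance : Trans (Eqv a) (Eqv a) (Eqv a) := ⟨trans⟩

theorem isTangle_iff (h : Eqv a S T) : IsTangle a S b ↔ IsTangle a T b := by
  induction h with
  | rel S T h =>
    obtain ⟨A, B, M, M', l, r, c, hM, hc, rfl, rfl⟩ := h
    obtain ⟨d, hA, hM'⟩ := isTangle_append_iff.1 hc
    obtain ⟨a₀, b₀, rfl, rfl, -, -, h5⟩ := hM.isTangle_whisker hM'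
    constructor
    · intro h
      obtain ⟨c, hc', hB⟩ := isTangle_append_iff.1 h
      rw [hc'.target_unique hc] at hB
      exact (hA.append h5).append hB
    · intro h
      obtain ⟨c, hc', hB⟩ := isTangle_append_iff.1 h
      rw [hc'.target_unique (hA.append h5)] at hB
      exact hc.append hB
  | refl S => rfl
  | symm S T _ ih => exact ih.symm
  | trans S T U _ _ ih ih' => exact ih.trans ih'

theorem append_right (h : Eqv a S T) (B : List Slice) : Eqv a (S ++ B) (T ++ B) := by
  induction h with
  | rel S T h =>
    obtain ⟨A, B', M, M', l, r, c, hM, hc, rfl, rfl⟩ := h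
    exact .rel _ _ ⟨A, B' ++ B, M, M', l, r, c, hM, hc, by simp, by simp⟩
  | refl S => exact refl _ _
  | symm S T _ ih => exact ih.symm
  | trans S T U _ _ ih ih' => exact ih.trans ih'

theorem append_left (hA : IsTangle c A a) (h : Eqv a S T) : Eqv c (A ++ S) (A ++ T) := by
  induction h with
  | rel S T h =>
    obtain ⟨A', B', M, M', l, r, d, hM, hc, rfl, rfl⟩ := h
    refine .rel _ _ ⟨A ++ A', B', M, M', l, r, d, hM, ?_, by simp, by simp⟩
    rw [List.append_assoc]
    exact hA.append hc
  | refl S => exact refl _ _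
  | symm S T _ ih => exact ih.symm
  | trans S T U _ _ ih ih' => exact ih.trans ih'

theorem whisker (l r : Strands) (h : Eqv a S T) :
    Eqv (l ++ a ++ r) (KnotTheory.whisker l r S) (KnotTheory.whisker l r T) := by
  induction h with
  | rel S T h =>
    obtain ⟨A, B, M, M', l', r', c, hM, hc, rfl, rfl⟩ := h
    refine .rel _ _ ⟨KnotTheory.whisker l r A, KnotTheory.whisker l r B, M, M', l ++ l', r' ++ r,
      l ++ c ++ r, hM, ?_, ?_, ?_⟩
    · rw [← whisker_whisker, ← whisker_append]
      exact hc.whisker l r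
    · simp only [whisker_append, whisker_whisker]
    · simp only [whisker_append, whisker_whisker]
  | refl S => exact refl _ _
  | symm S T _ ih => exact ih.symm
  | trans S T U _ _ ih ih' => exact ih.trans ih'

/-- Replace a part of a tangle by an isotopic one. -/
theorem context (A B : List Slice) (l r : Strands) (h : Eqv b S T)
    (hA : IsTangle a A (l ++ b ++ r)) :
    Eqv a (A ++ (KnotTheory.whisker l r S ++ B)) (A ++ (KnotTheory.whisker l r T ++ B)) :=
  append_left hA ((h.whisker l r).append_right B)

theorem of_localMove {M M' : List Slice} (h : LocalMove M M') (hM : IsTangle a M b) :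
    Eqv a M M' := by
  have key : ∀ T : List Slice, KnotTheory.whisker [] [] T = T := by
    intro T
    exact List.map_id'' (fun s => by simp) T
  refine .rel _ _ ⟨[], [], M, M', [], [], b, h, ?_, ?_, ?_⟩
  · rwa [key]
  · rw [key]; simp
  · rw [key]; simp

theorem slice_interchange (g h : Event) (l m r : Strands) :
    Eqv (l ++ g.src ++ m ++ h.src ++ r) [⟨l, g, m ++ h.src ++ r⟩, ⟨l ++ g.tgt ++ m, h, r⟩]
      [⟨l ++ g.src ++ m, h, r⟩, ⟨l, g, m ++ h.tgt ++ r⟩] := by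
  have := (of_localMove (.interchange g h m) (a := g.src ++ m ++ h.src)
    (b := g.tgt ++ m ++ h.tgt) (by simp)).whisker l r
  simpa using this

theorem slice_interchange_stack (g : Event) (l m r : Strands) {c d : Strands} {T : List Slice}
    (hT : IsTangle c T d) :
    Eqv (l ++ g.src ++ m ++ c ++ r)
      (⟨l, g, m ++ c ++ r⟩ :: KnotTheory.whisker (l ++ g.tgt ++ m) r T)
      (KnotTheory.whisker (l ++ g.src ++ m) r T ++ [⟨l, g, m ++ d ++ r⟩]) := by
  induction T generalizing c with
  | nil => cases hT; exact refl _ _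
  | cons t T ih =>
    obtain ⟨l', h, r'⟩ := t
    obtain ⟨rfl, hT⟩ := hT
    have h1 := (slice_interchange g h l (m ++ l') (r' ++ r)).append_right
      (KnotTheory.whisker (l ++ g.tgt ++ m) r T)
    have h2 := append_left (A := [⟨l ++ g.src ++ m ++ l', h, r' ++ r⟩])
      (c := l ++ g.src ++ m ++ (l' ++ h.src ++ r') ++ r) (by simp) (ih hT)
    simp only [KnotTheory.whisker, Slice.whisker, Slice.src, Slice.tgt, List.map_cons,
      List.cons_append, List.nil_append, List.append_assoc] at h1 h2 ⊢
    exact h1.trans h2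

/-- Two parts of a diagram that lie side by side exchange their heights. -/
theorem interchange {a b c d : Strands} {S T : List Slice} (hS : IsTangle a S b)
    (hT : IsTangle c T d) (m : Strands) :
    Eqv (a ++ m ++ c) (KnotTheory.whisker [] (m ++ c) S ++ KnotTheory.whisker (b ++ m) [] T)
      (KnotTheory.whisker (a ++ m) [] T ++ KnotTheory.whisker [] (m ++ d) S) := by
  induction S generalizing a with
  | nil => cases hS; simpa using refl _ _
  | cons s S ih =>
    obtain ⟨l, g, r⟩ := s
    obtain ⟨rfl, hS⟩ := hS
    have h1 := append_left (A := [⟨l, g, r ++ (m ++ c)⟩])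
      (c := l ++ g.src ++ r ++ (m ++ c)) (by simp) (ih hS)
    have h2 := (slice_interchange_stack g l (r ++ m) [] hT).append_right
      (KnotTheory.whisker [] (m ++ d) S)
    simp only [KnotTheory.whisker, Slice.whisker, Slice.src, Slice.tgt, List.map_cons,
      List.cons_append, List.nil_append, List.append_assoc, List.append_nil] at h1 h2 ⊢
    exact h1.trans h2

/-! #### The local moves and consequences -/

theorem reidemeister_two (p x y : Bool) :
    Eqv [x, y] [⟨[], .cross p x y, []⟩, ⟨[], .cross (!p) y x, []⟩] [] :=
  of_localMove (.reidemeister_two p x y) (b := [x, y]) (by simp)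

theorem slide_cap (p x y : Bool) :
    Eqv [y, x, !x] [⟨[], .cross p y x, [!x]⟩, ⟨[x], .cross p y (!x), []⟩, ⟨[], .cap x, [y]⟩]
      [⟨[y], .cap x, []⟩] :=
  of_localMove (.slide_cap p x y) (b := [y]) (by simp)

theorem slide_cup (p x y : Bool) :
    Eqv [y] [⟨[], .cup x, [y]⟩, ⟨[x], .cross p (!x) y, []⟩, ⟨[], .cross p x y, [!x]⟩]
      [⟨[y], .cup x, []⟩] :=
  of_localMove (.slide_cup p x y) (b := [y, x, !x]) (by simp)

theorem reidemeister_one_cap (p x : Bool) :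
    Eqv [x, !x] [⟨[], .cross p x (!x), []⟩, ⟨[], .cap (!x), []⟩] [⟨[], .cap x, []⟩] :=
  of_localMove (.reidemeister_one_cap p x) (b := []) (by simp)

theorem reidemeister_one_cup (p x : Bool) :
    Eqv [] [⟨[], .cup x, []⟩, ⟨[], .cross p x (!x), []⟩] [⟨[], .cup (!x), []⟩] :=
  of_localMove (.reidemeister_one_cup p x) (b := [!x, x]) (by simp)

theorem reidemeister_three (p x y z : Bool) :
    Eqv [x, y, z] [⟨[], .cross p x y, [z]⟩, ⟨[y], .cross p x z, []⟩, ⟨[], .cross p y z, [x]⟩]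
      [⟨[x], .cross p y z, []⟩, ⟨[], .cross p x z, [y]⟩, ⟨[z], .cross p x y, []⟩] :=
  of_localMove (.reidemeister_three p x y z) (b := [z, y, x]) (by simp)

theorem zigzag_left (x : Bool) : Eqv [x] [⟨[x], .cup (!x), []⟩, ⟨[], .cap x, [x]⟩] [] :=
  of_localMove (.zigzag_left x) (b := [x]) (by simp)

theorem zigzag_right (x : Bool) : Eqv [x] [⟨[], .cup x, [x]⟩, ⟨[x], .cap (!x), []⟩] [] :=
  of_localMove (.zigzag_right x) (b := [x]) (by simp)

theorem reidemeister_two' (p x y : Bool) :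
    Eqv [x, y] [⟨[], .cross (!p) x y, []⟩, ⟨[], .cross p y x, []⟩] [] := by
  simpa using reidemeister_two (!p) x y

/-- A crossing below a maximum moves to the other leg of the maximum. -/
theorem cross_cap (p x y : Bool) :
    Eqv [x, y, !x] [⟨[], .cross p x y, [!x]⟩, ⟨[y], .cap x, []⟩]
      [⟨[x], .cross (!p) y (!x), []⟩, ⟨[], .cap x, [y]⟩] := by
  have h1 := (slide_cap (!p) x y).context (a := [x, y, !x]) [⟨[], .cross p x y, [!x]⟩] [] [] []
    (by simp)
  have h2 := (reidemeister_two p x y).context (a := [x, y, !x]) []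
    [⟨[x], .cross (!p) y (!x), []⟩, ⟨[], .cap x, [y]⟩] [] [!x] (by simp)
  simp at h1 h2
  exact h1.symm.trans h2

/-- A crossing above a minimum moves to the other leg of the minimum. -/
theorem cup_cross (p x y : Bool) :
    Eqv [y] [⟨[y], .cup x, []⟩, ⟨[], .cross p y x, [!x]⟩]
      [⟨[], .cup x, [y]⟩, ⟨[x], .cross (!p) (!x) y, []⟩] := by
  have h1 := (slide_cup (!p) x y).context (a := [y]) [] [⟨[], .cross p y x, [!x]⟩] [] []
    (by simp)
  have h2 := (reidemeister_two' p x y).context (a := [y])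
    [⟨[], .cup x, [y]⟩, ⟨[x], .cross (!p) (!x) y, []⟩] [] [] [!x] (by simp)
  simp at h1 h2
  exact h1.symm.trans h2

/-- A curl is removed. -/
theorem curl (p : Bool) :
    Eqv [true] [⟨[true], .cup true, []⟩, ⟨[], .cross p true true, [false]⟩, ⟨[true], .cap true, []⟩]
      [] := by
  have h1 := (cross_cap p true true).context (a := [true]) [⟨[true], .cup true, []⟩] [] [] []
    (by simp)
  have h2 := (reidemeister_one_cup (!p) true).context (a := [true]) []
    [⟨[], .cap true, [true]⟩] [true] [] (by simp)
  have h3 := zigzag_left true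
  simp at h1 h2 h3
  exact h1.trans (h2.trans h3)

/-- An upward crossing turned by a quarter. -/
theorem rotate_cross_left (p : Bool) :
    Eqv [true, false] [⟨[], .cup false, [true, false]⟩, ⟨[false], .cross p true true, [false]⟩,
      ⟨[false, true], .cap true, []⟩] [⟨[], .cross (!p) true false, []⟩] := by
  have h1 := (cross_cap p true true).context (a := [true, false])
    [⟨[], .cup false, [true, false]⟩] [] [false] [] (by simp)
  have h2 := (slice_interchange (.cup false) (.cross (!p) true false) [] [] []).context
    (a := [true, false]) [] [⟨[false], .cap true, [true]⟩] [] [] (by simp)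
  have h3 := (zigzag_right false).context (a := [true, false])
    [⟨[], .cross (!p) true false, []⟩] [] [] [true] (by simp)
  simp at h1 h2 h3
  exact h1.trans (h2.trans h3)

/-- An upward crossing turned by a quarter. -/
theorem rotate_cross_right (p : Bool) :
    Eqv [false, true] [⟨[false, true], .cup true, []⟩, ⟨[false], .cross p true true, [false]⟩,
      ⟨[], .cap false, [true, false]⟩] [⟨[], .cross (!p) false true, []⟩] := by
  have h1 := (cup_cross p true true).context (a := [false, true])
    [] [⟨[], .cap false, [true, false]⟩] [false] [] (by simp)
  have h2 := (slice_interchange (.cap false) (.cross (!p) false true) [] [] []).context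
    (a := [false, true]) [⟨[false], .cup true, [true]⟩] [] [] [] (by simp)
  have h3 := (zigzag_left false).context (a := [false, true])
    [] [⟨[], .cross (!p) false true, []⟩] [] [true] (by simp)
  simp at h1 h2 h3
  exact h1.trans (h2.symm.trans h3)

/-- A crossing slides through two nested minima. -/
theorem nested_cups_cross (p : Bool) :
    Eqv [] [⟨[], .cup true, []⟩, ⟨[true], .cup true, [false]⟩,
        ⟨[true, true], .cross p false false, []⟩]
      [⟨[], .cup true, []⟩, ⟨[true], .cup true, [false]⟩,
        ⟨[], .cross p true true, [false, false]⟩] := by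
  have h1 := (cup_cross (!p) true false).context (a := []) [⟨[], .cup true, []⟩] [] [true] []
    (by simp)
  have h2 := (cup_cross p true true).context (a := []) [⟨[], .cup true, []⟩] [] [] [false]
    (by simp)
  have h3 := (slice_interchange (.cup true) (.cup true) [] [] []).context (a := []) []
    [⟨[true], .cross (!p) false true, [false]⟩] [] [] (by simp)
  simp at h1 h2 h3
  exact h1.symm.trans (h3.trans h2.symm)

/-- A circle passes through a strand. -/
theorem circle_slide (y : Bool) :
    Eqv [y] [⟨[y], .cup true, []⟩, ⟨[y], .cap true, []⟩]
      [⟨[], .cup true, [y]⟩, ⟨[], .cap true, [y]⟩] := by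
  have h1 := (slide_cup true true y).context (a := [y]) [] [⟨[y], .cap true, []⟩] [] [] (by simp)
  have h2 := (slide_cap false true y).context (a := [y]) [⟨[], .cup true, [y]⟩,
    ⟨[true], .cross true false y, []⟩, ⟨[], .cross true true y, [false]⟩] [] [] [] (by simp)
  have h3 := (reidemeister_two true true y).context (a := [y]) [⟨[], .cup true, [y]⟩,
    ⟨[true], .cross true false y, []⟩] [⟨[true], .cross false y false, []⟩, ⟨[], .cap true, [y]⟩]
    [] [false] (by simp)
  have h4 := (reidemeister_two true false y).context (a := [y]) [⟨[], .cup true, [y]⟩]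
    [⟨[], .cap true, [y]⟩] [true] [] (by simp)
  simp at h1 h2 h3 h4
  exact h1.symm.trans (h2.symm.trans (h3.trans h4))

/-- If a crossing slides through a tangle, then so does the opposite crossing. -/
theorem cross_slide_not {p w : Bool} {l r l' r' : Strands}
    (hS : IsTangle (l ++ [w, w] ++ r) S (l' ++ [w, w] ++ r'))
    (h : Eqv (l ++ [w, w] ++ r) (⟨l, .cross p w w, r⟩ :: S) (S ++ [⟨l', .cross p w w, r'⟩])) :
    Eqv (l ++ [w, w] ++ r) (⟨l, .cross (!p) w w, r⟩ :: S) (S ++ [⟨l', .cross (!p) w w, r'⟩]) := by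
  have h1 := (reidemeister_two p w w).context S [] l' r' hS
  have h2 := append_left (A := [⟨l, .cross (!p) w w, r⟩]) (c := l ++ [w, w] ++ r) (by simp)
    (h.append_right [⟨l', .cross (!p) w w, r'⟩])
  have h3 := (reidemeister_two' p w w).context (a := l ++ [w, w] ++ r) []
    (S ++ [⟨l', .cross (!p) w w, r'⟩]) l r (by simp)
  have h4 := append_left (A := [⟨l, .cross (!p) w w, r⟩]) (c := l ++ [w, w] ++ r) (by simp) h1
  simp at h1 h2 h3 h4 ⊢
  exact h4.symm.trans (h2.symm.trans h3)

/-- A downward strand slides over a crossing of upward strands. -/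
theorem over_slide_up (p : Bool) :
    Eqv [true, true, false] [⟨[], .cross p true true, [false]⟩,
        ⟨[true], .cross false true false, []⟩, ⟨[], .cross false true false, [true]⟩]
      [⟨[true], .cross false true false, []⟩, ⟨[], .cross false true false, [true]⟩,
        ⟨[false], .cross p true true, []⟩] := by
  have h := reidemeister_three false true true false
  cases p
  · exact h
  · exact cross_slide_not (p := false) (l := []) (r := [false]) (l' := [false]) (r' := [])
      (S := [⟨[true], .cross false true false, []⟩, ⟨[], .cross false true false, [true]⟩])
      (by simp) h

/-- A crossing of downward strands slides over an upward strand. -/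
theorem over_slide_down (p : Bool) :
    Eqv [true, false, false] [⟨[true], .cross p false false, []⟩,
        ⟨[], .cross false true false, [false]⟩, ⟨[false], .cross false true false, []⟩]
      [⟨[], .cross false true false, [false]⟩, ⟨[false], .cross false true false, []⟩,
        ⟨[], .cross p false false, [true]⟩] := by
  have h := (reidemeister_three false true false false).symm
  cases p
  · exact h
  · exact cross_slide_not (p := false) (l := [true]) (r := []) (l' := []) (r' := [true])
      (S := [⟨[], .cross false true false, [false]⟩, ⟨[false], .cross false true false, []⟩])
      (by simp) h

end Eqv

/-! ### Sorting the strands -/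

/-- `m` upward strands. -/
abbrev ups (m : ℕ) : Strands := List.replicate m true

/-- `m` downward strands. -/
abbrev downs (m : ℕ) : Strands := List.replicate m false

/-- A downward strand moves from the right over `m` upward strands to the left. -/
def overLeft : ℕ → List Slice
  | 0 => []
  | m + 1 => whisker [true] [] (overLeft m) ++ [⟨[], .cross false true false, ups m⟩]

/-- The downward strands of a row move over the upward ones from the right to their places. -/
def unsort : Strands → List Slice
  | [] => []
  | true :: a => whisker [true] [] (unsort a)
  | false :: a => whisker [] (downs (a.count false)) (overLeft (a.count true)) ++
      whisker [false] [] (unsort a)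

/-- The sorted row of strands. -/
def sorted (a : Strands) : Strands := ups (a.count true) ++ downs (a.count false)

theorem isTangle_overLeft (m : ℕ) : IsTangle (ups m ++ [false]) (overLeft m) ([false] ++ ups m) := by
  induction m with
  | zero => simp [overLeft]
  | succ m ih =>
    rw [overLeft]
    have := ih.whisker [true] []
    refine IsTangle.append (b := [true] ++ ([false] ++ ups m) ++ []) ?_ (by simp [List.replicate_succ])
    simpa [List.replicate_succ] using this

theorem isTangle_unsort (a : Strands) : IsTangle (sorted a) (unsort a) a := by
  induction a with
  | nil => simp [unsort, sorted]
  | cons x a ih =>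
    cases x
    · rw [unsort]
      have h1 := (isTangle_overLeft (a.count true)).whisker [] (downs (a.count false))
      have h2 := ih.whisker [false] []
      refine IsTangle.append (b := [false] ++ sorted a) ?_ (by simpa using h2)
      simpa [sorted, List.replicate_succ] using h1
    · rw [unsort]
      simpa [sorted, List.replicate_succ] using ih.whisker [true] []

theorem unsort_downs (m : ℕ) : unsort (downs m) = [] := by
  induction m with
  | zero => rfl
  | succ m ih => simp [List.replicate_succ, unsort, ih, List.count_replicate, overLeft]

/-- At a sorted row a standard tangle therefore ends with its braid, which makes the middle of such
a row the convenient place for maxima and minima. -/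
theorem unsort_ups_downs (m n : ℕ) : unsort (ups m ++ downs n) = [] := by
  induction m with
  | zero => simpa using unsort_downs n
  | succ m ih => simp [List.replicate_succ, unsort, ih]

/-- A crossing of two neighbouring strands of a sorted row with `m` upward and `n` downward
strands, if they have the same direction. -/
inductive SortedCross (m n : ℕ) : List Slice → Prop
  | none : SortedCross m n []
  | up (p : Bool) (i j : ℕ) : i + 2 + j = m →
      SortedCross m n [⟨ups i, .cross p true true, ups j ++ downs n⟩]
  | down (p : Bool) (i j : ℕ) : i + 2 + j = n →
      SortedCross m n [⟨ups m ++ downs i, .cross p false false, downs j⟩]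

theorem ups_split (i j : ℕ) : ups (i + 2 + j) = ups i ++ true :: true :: ups j := by
  rw [ups, List.replicate_add, List.replicate_add]; simp [List.replicate_succ]

theorem downs_split (i j : ℕ) : downs (i + 2 + j) = downs i ++ false :: false :: downs j := by
  rw [downs, List.replicate_add, List.replicate_add]; simp [List.replicate_succ]

/-- The moving strand lies over all others, so a crossing beneath it slides through by a third
Reidemeister move, whatever its type; the remaining crossings of that strand are far away and
commute. -/
theorem overLeft_up (p : Bool) (i j : ℕ) :
    Eqv (ups (i + 2 + j) ++ [false])
      (⟨ups i, .cross p true true, ups j ++ [false]⟩ :: overLeft (i + 2 + j))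
      (overLeft (i + 2 + j) ++ [⟨false :: ups i, .cross p true true, ups j⟩]) := by
  induction i with
  | zero =>
    have h0 : overLeft (0 + 2 + j) = whisker [true, true] [] (overLeft j) ++
        [⟨[true], .cross false true false, ups j⟩, ⟨[], .cross false true false, true :: ups j⟩] := by
      rw [show 0 + 2 + j = j + 1 + 1 by omega, overLeft, overLeft, whisker_append, whisker_whisker]
      simp [List.replicate_succ]
    have h1 := Eqv.interchange (S := [⟨[], .cross p true true, []⟩]) (a := [true, true])
      (b := [true, true]) (by simp) (isTangle_overLeft j) []
    have h2 := (Eqv.over_slide_up p).context (a := ups (0 + 2 + j) ++ [false])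
      (whisker [true, true] [] (overLeft j)) [] [] (ups j)
      (by
        have := (isTangle_overLeft j).whisker [true, true] []
        rw [show 0 + 2 + j = j + 1 + 1 by omega]
        simpa [List.replicate_succ] using this)
    rw [h0]
    have h3 := h1.append_right [⟨[true], .cross false true false, ups j⟩,
      ⟨[], .cross false true false, true :: ups j⟩]
    have h4 : ups (0 + 2 + j) ++ [false] = [true, true] ++ [] ++ (ups j ++ [false]) := by
      rw [show 0 + 2 + j = j + 1 + 1 by omega]; simp [List.replicate_succ]
    rw [h4] at h2 ⊢
    simp at h2 h3 ⊢
    exact h3.trans h2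
  | succ i ih =>
    have he := ups_split i j
    have h0 : overLeft (i + 1 + 2 + j) = whisker [true] [] (overLeft (i + 2 + j)) ++
        [⟨[], .cross false true false, ups (i + 2 + j)⟩] := by
      rw [show i + 1 + 2 + j = i + 2 + j + 1 by omega, overLeft]
    have h1 := (ih.whisker [true] []).append_right
        [⟨[], .cross false true false, ups (i + 2 + j)⟩]
    have h4 : ups (i + 1 + 2 + j) ++ [false] = [true] ++ (ups (i + 2 + j) ++ [false]) := by
      rw [show i + 1 + 2 + j = i + 2 + j + 1 by omega]; simp [List.replicate_succ]
    have h2 := (Eqv.slice_interchange (.cross false true false) (.cross p true true) [] (ups i)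
      (ups j)).symm.context (a := ups (i + 1 + 2 + j) ++ [false])
      (whisker [true] [] (overLeft (i + 2 + j))) [] [] [] (by
        have := (isTangle_overLeft (i + 2 + j)).whisker [true] []
        rw [h4]
        simpa [he] using this)
    rw [h0]
    rw [h4] at h2 ⊢
    simp [List.replicate_succ, he] at h1 h2 ⊢
    exact h1.trans h2

theorem isTangle_overLeft_overLeft (m : ℕ) :
    IsTangle (ups m ++ [false, false])
      (whisker [] [false] (overLeft m) ++ whisker [false] [] (overLeft m))
      ([false, false] ++ ups m) := by
  refine IsTangle.append (b := [false] ++ ups m ++ [false]) ?_ ?_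
  · simpa using (isTangle_overLeft m).whisker [] [false]
  · simpa using (isTangle_overLeft m).whisker [false] []

theorem overLeft_down (p : Bool) (m : ℕ) :
    Eqv (ups m ++ [false, false])
      (⟨ups m, .cross p false false, []⟩ ::
        (whisker [] [false] (overLeft m) ++ whisker [false] [] (overLeft m)))
      (whisker [] [false] (overLeft m) ++ whisker [false] [] (overLeft m) ++
        [⟨[], .cross p false false, ups m⟩]) := by
  induction m with
  | zero => simpa [overLeft] using Eqv.refl _ _
  | succ m ih =>
    -- Reordered so that both downward strands first pass the `m` right-hand upward strands, where
    -- the induction hypothesis applies, and only then the leftmost one.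
    have comm : Eqv (true :: (ups m ++ [false, false]))
        (whisker [] [false] (overLeft (m + 1)) ++ whisker [false] [] (overLeft (m + 1)))
        (whisker [true] [] (whisker [] [false] (overLeft m) ++ whisker [false] [] (overLeft m)) ++
          [⟨[], .cross false true false, false :: ups m⟩,
            ⟨[false], .cross false true false, ups m⟩]) := by
      have h1 := (Eqv.interchange (S := [⟨[], .cross false true false, []⟩]) (a := [true, false])
        (b := [false, true]) (by simp) (isTangle_overLeft m) []).append_right
        [⟨[false], .cross false true false, ups m⟩]
      have h2 := Eqv.append_left (c := true :: (ups m ++ [false, false]))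
        (A := whisker [true] [false] (overLeft m)) (by
          simpa using (isTangle_overLeft m).whisker [true] [false]) h1
      simpa [overLeft] using h2
    have h1 := Eqv.append_left (A := [⟨ups (m + 1), .cross p false false, []⟩])
      (c := true :: (ups m ++ [false, false])) (by simp [List.replicate_succ]) comm
    have h2 := (ih.whisker [true] []).append_right
      [⟨[], .cross false true false, false :: ups m⟩, ⟨[false], .cross false true false, ups m⟩]
    have h3 := (Eqv.over_slide_down p).context (a := true :: (ups m ++ [false, false]))
      (whisker [true] [] (whisker [] [false] (overLeft m) ++ whisker [false] [] (overLeft m)))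
      [] [] (ups m) (by simpa using (isTangle_overLeft_overLeft m).whisker [true] [])
    have h4 := comm.symm.append_right [⟨[], .cross p false false, ups (m + 1)⟩]
    simp [List.replicate_succ] at h1 h2 h3 h4 ⊢
    exact h1.trans (h2.trans (h3.trans h4))

/-- A crossing above the unsorting of a row is absorbed, or slides to its bottom. -/
theorem exists_unsort_cross (l r : Strands) (p x y : Bool) (hp : x = y ∨ p = !x) :
    ∃ V, SortedCross ((l ++ x :: y :: r).count true) ((l ++ x :: y :: r).count false) V ∧
      Eqv (sorted (l ++ x :: y :: r)) (unsort (l ++ x :: y :: r) ++ [⟨l, .cross p x y, r⟩])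
        (V ++ unsort (l ++ y :: x :: r)) := by
  -- By `hp` the strands are parallel, or the downward one is on top as in `overLeft`. Opposite
  -- strands give a crossing that extends or cancels the rearrangement (`V` is empty); parallel ones
  -- give a crossing that slides down.
  induction l with
  | nil =>
    simp only [List.nil_append]
    have hr := isTangle_unsort r
    cases x <;> cases y
    · refine ⟨_, .down p 0 (r.count false) (by simp; omega), ?_⟩
      have h0 := (isTangle_overLeft_overLeft (r.count true)).whisker [] (downs (r.count false))
      have h1 := Eqv.append_left h0 (by
        simpa [sorted] using (Eqv.interchange (S := [⟨[], .cross p false false, []⟩])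
          (a := [false, false]) (b := [false, false]) (by simp) hr []))
      have h2 := ((overLeft_down p (r.count true)).whisker [] (downs (r.count false))).append_right
        (whisker [false, false] [] (unsort r))
      simp [unsort, sorted, List.replicate_succ] at h1 h2 ⊢
      exact h1.symm.trans h2.symm
    · obtain rfl : p = true := by simpa using hp
      refine ⟨_, .none, ?_⟩
      have h0 := (isTangle_overLeft (r.count true)).whisker [true] (downs (r.count false))
      have h1 := (Eqv.append_left h0 (by
        simpa [sorted] using (Eqv.interchange (S := [⟨[], .cross false true false, []⟩])
          (a := [true, false]) (b := [false, true]) (by simp) hr []))).append_right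
            [⟨[], .cross true false true, r⟩]
      have h2 := (Eqv.reidemeister_two false true false).context (whisker [true]
        (downs (r.count false)) (overLeft (r.count true)) ++ whisker [true, false] [] (unsort r)) []
        [] r (h0.append (by simpa [sorted] using hr.whisker [true, false] []))
      simp [unsort, sorted, List.replicate_succ, overLeft] at h1 h2 ⊢
      exact h1.trans h2
    · obtain rfl : p = false := by simpa using hp
      refine ⟨_, .none, ?_⟩
      have h0 := (isTangle_overLeft (r.count true)).whisker [true] (downs (r.count false))
      have h1 := Eqv.append_left h0 (by
        simpa [sorted] using (Eqv.interchange (S := [⟨[], .cross false true false, []⟩])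
          (a := [true, false]) (b := [false, true]) (by simp) hr []))
      simp [unsort, sorted, List.replicate_succ, overLeft] at h1 ⊢
      exact h1.symm
    · refine ⟨_, .up p 0 (r.count true) (by simp; omega), ?_⟩
      have h1 := Eqv.interchange (S := [⟨[], .cross p true true, []⟩]) (a := [true, true])
        (b := [true, true]) (by simp) (isTangle_unsort r) []
      simp [unsort, sorted, List.replicate_succ] at h1 ⊢
      exact h1.symm
  | cons z l ih =>
    obtain ⟨V, hV, h⟩ := ih
    cases z
    · have h0 := (isTangle_overLeft ((l ++ x :: y :: r).count true)).whisker []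
        (downs ((l ++ x :: y :: r).count false))
      have h1 := Eqv.append_left h0 (by simpa [sorted] using h.whisker [false] [])
      have hc : (l ++ y :: x :: r).count true = (l ++ x :: y :: r).count true ∧
          (l ++ y :: x :: r).count false = (l ++ x :: y :: r).count false := by
        constructor <;> exact List.Perm.count_eq ((List.Perm.swap _ _ _).append_left l) _
      have hs : sorted (false :: (l ++ x :: y :: r)) = ups ((l ++ x :: y :: r).count true) ++
          downs ((l ++ x :: y :: r).count false + 1) := by simp [sorted]
      rw [List.cons_append, List.cons_append, unsort, unsort, hs,
        List.count_cons_of_ne (by simp), List.count_cons_self, hc.1, hc.2]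
      clear hs hc h h0
      generalize unsort (l ++ x :: y :: r) = W at *
      generalize unsort (l ++ y :: x :: r) = W' at *
      generalize (l ++ x :: y :: r).count true = m at *
      generalize (l ++ x :: y :: r).count false = n at *
      -- It remains to slide `V` down past the one downward strand that `overLeft` brings to the far
      -- left.
      suffices key : ∃ V', SortedCross m (n + 1) V' ∧ Eqv (ups m ++ downs (n + 1))
          (whisker [] (downs n) (overLeft m) ++ whisker [false] [] V)
          (V' ++ whisker [] (downs n) (overLeft m)) by
        obtain ⟨V', hV', h2⟩ := key
        refine ⟨V', hV', ?_⟩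
        have h3 := h2.append_right (whisker [false] [] W')
        simp [List.replicate_succ] at h1 h3 ⊢
        exact h1.trans h3
      cases hV with
      | none => exact ⟨_, .none, by simpa using Eqv.refl _ _⟩
      | up q i j hij =>
        subst hij
        refine ⟨_, .up q i j rfl, ?_⟩
        have h3 := (overLeft_up q i j).whisker [] (downs n)
        simp [List.replicate_succ] at h3 ⊢
        exact h3.symm
      | down q i j hij =>
        subst hij
        refine ⟨_, .down q (i + 1) j (by omega), ?_⟩
        have h3 := Eqv.interchange (isTangle_overLeft m) (c := downs (i + 2 + j))
          (d := downs (i + 2 + j)) (T := [⟨downs i, .cross q false false, downs j⟩])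
          (by simp [downs_split]) []
        simp [List.replicate_succ] at h3 ⊢
        exact h3
    · refine ⟨whisker [true] [] V, ?_, ?_⟩
      · cases hV with
        | none => exact .none
        | up p i j hij =>
          have := SortedCross.up (n := (true :: (l ++ x :: y :: r)).count false) p (i + 1) j
            (m := (true :: (l ++ x :: y :: r)).count true) (by simp at hij ⊢; omega)
          simpa [List.replicate_succ] using this
        | down p i j hij =>
          have := SortedCross.down (n := (true :: (l ++ x :: y :: r)).count false) p i j
            (m := (true :: (l ++ x :: y :: r)).count true) (by simp at hij ⊢; omega)
          simpa [List.replicate_succ] using this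
      · have := h.whisker [true] []
        simpa [unsort, sorted, List.replicate_succ] using this

end Calculus

/-! ### Standard tangles, and adding a crossing to them. -/

section Spanning

attribute [local simp] IsTangle Slice.src Slice.tgt Event.src Event.tgt whisker Slice.whisker
  sliceWhisker_comp

/-! ### Standard tangles -/

theorem ups_succ (m : ℕ) : ups (m + 1) = ups m ++ [true] := List.replicate_succ'

theorem downs_succ (m : ℕ) : downs (m + 1) = false :: downs m := List.replicate_succ

/-- `j` circles without crossings, one above the other. -/
def circles : ℕ → List Slice
  | 0 => []
  | j + 1 => [⟨[], .cup true, []⟩, ⟨[], .cap true, []⟩] ++ circles j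

/-- `m` nested minima. -/
def nest : ℕ → List Slice
  | 0 => []
  | m + 1 => nest m ++ [⟨ups m, .cup true, downs m⟩]

theorem isTangle_circles (j : ℕ) : IsTangle [] (circles j) [] := by
  induction j with
  | zero => rfl
  | succ j ih => exact ⟨rfl, rfl, ih⟩

theorem isTangle_nest (m : ℕ) : IsTangle [] (nest m) (ups m ++ downs m) := by
  induction m with
  | zero => simp [nest]
  | succ m ih => exact ih.append (by simp [ups_succ, downs_succ])

/-- A stack of crossings of `m` upward strands. -/
def IsBraid (m : ℕ) (W : List Slice) : Prop :=
  ∀ s ∈ W, ∃ (p : Bool) (i j : ℕ), i + 2 + j = m ∧ s = ⟨ups i, .cross p true true, ups j⟩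

theorem IsBraid.append {m : ℕ} {V W : List Slice} (hV : IsBraid m V) (hW : IsBraid m W) :
    IsBraid m (V ++ W) := by
  intro s hs
  rcases List.mem_append.1 hs with h | h
  exacts [hV s h, hW s h]

theorem isBraid_singleton (p : Bool) (i j : ℕ) :
    IsBraid (i + 2 + j) [⟨ups i, .cross p true true, ups j⟩] := by
  intro s hs
  rw [List.mem_singleton] at hs
  exact ⟨p, i, j, rfl, hs⟩

theorem IsBraid.isTangle {m : ℕ} {W : List Slice} (hW : IsBraid m W) :
    IsTangle (ups m) W (ups m) := by
  induction W with
  | nil => rfl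
  | cons s W ih =>
    obtain ⟨p, i, j, rfl, rfl⟩ := hW s List.mem_cons_self
    refine ⟨by simp [ups_split], ?_⟩
    have := ih fun s hs => hW s (List.mem_cons_of_mem _ hs)
    simpa [ups_split] using this

theorem IsBraid.succ {m : ℕ} {W : List Slice} (hW : IsBraid m W) :
    IsBraid (m + 1) (whisker [] [true] W) := by
  intro s hs
  obtain ⟨t, ht, rfl⟩ := List.mem_map.1 hs
  obtain ⟨p, i, j, rfl, rfl⟩ := hW t ht
  exact ⟨p, i, j + 1, by omega, by simp [ups_succ]⟩

/-- Nested minima pair the strands symmetrically about the middle, hence `i` and `j` trade places.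
For the two innermost minima this is `nested_cups_cross`; otherwise the innermost minimum first
moves above the crossing. Crossings of downward strands thus turn into braid generators of upward
ones. -/
theorem nest_cross (p : Bool) (i j : ℕ) :
    Eqv [] (nest (i + 2 + j) ++ [⟨ups (i + 2 + j) ++ downs i, .cross p false false, downs j⟩])
      (nest (i + 2 + j) ++ [⟨ups j, .cross p true true, ups i ++ downs (i + 2 + j)⟩]) := by
  induction i with
  | zero =>
    have h := (Eqv.nested_cups_cross p).context (a := []) (nest j) [] (ups j) (downs j)
      (by simpa using isTangle_nest j)
    rw [show 0 + 2 + j = j + 1 + 1 by omega]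
    simp [nest, ups_succ, downs_succ] at h ⊢
    exact h
  | succ i ih =>
    have hm := isTangle_nest (i + 2 + j)
    rw [show i + 1 + 2 + j = i + 2 + j + 1 by omega]
    have h1 := (Eqv.slice_interchange (.cup true) (.cross p false false) (ups (i + 2 + j))
      (downs i) (downs j)).context (a := []) (nest (i + 2 + j)) [] [] []
      (by simpa [downs_split] using hm)
    have h2 := ih.append_right [⟨ups (i + 2 + j), .cup true, downs (i + 2 + j)⟩]
    have h3 := (Eqv.slice_interchange (.cross p true true) (.cup true) (ups j) (ups i)
      (downs (i + 2 + j))).context (a := []) (nest (i + 2 + j)) [] [] []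
      (by simpa [ups_split, show i + 2 + j = j + 2 + i by omega] using hm)
    have e1 : ups j ++ true :: true :: ups i = ups (i + 2 + j) := by
      rw [← ups_split, show j + 2 + i = i + 2 + j by omega]
    have e2 : downs i ++ false :: false :: downs j = downs (i + 2 + j) := by
      rw [← downs_split]
    simp [nest, ups_succ, downs_succ] at h1 h2 h3 ⊢
    simp only [e1, e2] at h1 h2 h3 ⊢
    exact h1.trans (h2.trans h3)

/-- The tangles that are reduced to standard ones by the skein relation. The standard tangles with
strands `a` at the top consist of circles, nested minima, a braid of the upward strands and the
unsorting of `a`. -/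
inductive Span (a : Strands) : List Slice → Prop
  | base (m j : ℕ) (W : List Slice) : a.count true = m → a.count false = m → IsBraid m W →
      Span a (circles j ++ nest m ++ whisker [] (downs m) W ++ unsort a)
  | iso {S T : List Slice} : Eqv [] S T → Span a S → Span a T
  | skein (p : Bool) (A : List Slice) (l r : Strands) (B : List Slice) :
      Span a (A ++ ⟨l, .cross (!p) true true, r⟩ :: B) → Span a (A ++ B) →
      Span a (A ++ ⟨l, .cross p true true, r⟩ :: B)

namespace Span

theorem isTangle_standard {a : Strands} {m j : ℕ} {W : List Slice} (h1 : a.count true = m)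
    (h2 : a.count false = m) (hW : IsBraid m W) :
    IsTangle [] (circles j ++ nest m ++ whisker [] (downs m) W ++ unsort a) a := by
  refine (((isTangle_circles j).append (isTangle_nest m)).append
    (c := ups m ++ downs m) ?_).append ?_
  · simpa using hW.isTangle.whisker [] (downs m)
  · have := isTangle_unsort a
    rwa [sorted, h1, h2] at this

theorem isTangle {a : Strands} {T : List Slice} (h : Span a T) : IsTangle [] T a := by
  induction h with
  | base m j W h1 h2 hW => exact isTangle_standard h1 h2 hW
  | iso h _ ih => exact h.isTangle_iff.1 ih
  | skein p A l r B _ _ ih _ => simpa [isTangle_append_iff] using ih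

/-- Isotopies and skein triples persist when slices are added on top, so an extension need only be
studied on standard tangles. -/
theorem append_of_base {a a' : Strands} {T E : List Slice} (h : Span a T)
    (hE : ∀ (m j : ℕ) (W : List Slice), a.count true = m → a.count false = m → IsBraid m W →
      Span a' (circles j ++ nest m ++ whisker [] (downs m) W ++ unsort a ++ E)) :
    Span a' (T ++ E) := by
  induction h with
  | base m j W h1 h2 hW => exact hE m j W h1 h2 hW
  | iso h _ ih => exact ih.iso (h.append_right E)
  | skein p A l r B _ _ ih ih' =>
    have := Span.skein (a := a') p A l r (B ++ E) (by simpa using ih) (by simpa using ih')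
    simpa using this

/-- Below the rearrangement the crossing becomes a generator: among upward strands it joins the top
of the braid; among downward strands it slides past the braid and through the nested minima to the
bottom of the braid. -/
theorem cross {l r : Strands} {x y : Bool} {T : List Slice} (p : Bool)
    (h : Span (l ++ x :: y :: r) T) (hp : x = y ∨ p = !x) :
    Span (l ++ y :: x :: r) (T ++ [⟨l, .cross p x y, r⟩]) := by
  refine h.append_of_base fun m j W h1 h2 hW => ?_
  obtain ⟨V, hV, hE⟩ := exists_unsort_cross l r p x y hp
  have hc : (l ++ y :: x :: r).count true = m ∧ (l ++ y :: x :: r).count false = m := by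
    constructor
    · exact (List.Perm.count_eq ((List.Perm.swap _ _ _).append_left l) _).trans h1
    · exact (List.Perm.count_eq ((List.Perm.swap _ _ _).append_left l) _).trans h2
  rw [sorted, h1, h2] at hE
  rw [h1, h2] at hV
  have hN : IsTangle [] (circles j ++ nest m ++ whisker [] (downs m) W) (ups m ++ downs m) :=
    ((isTangle_circles j).append (isTangle_nest m)).append
      (by simpa using hW.isTangle.whisker [] (downs m))
  refine Span.iso (S := circles j ++ nest m ++ whisker [] (downs m) W ++ V ++
    unsort (l ++ y :: x :: r)) ?_ ?_
  · simpa using Eqv.append_left hN hE.symm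
  · cases hV with
    | none => simpa using Span.base m j W hc.1 hc.2 hW
    | up q i k hik =>
      subst hik
      have := Span.base _ j _ hc.1 hc.2 (hW.append (isBraid_singleton q i k))
      simpa using this
    | down q i k hik =>
      subst hik
      have h3 := Eqv.append_left ((isTangle_circles j).append (isTangle_nest (i + 2 + k)))
        (by simpa using ((Eqv.interchange hW.isTangle (c := downs (i + 2 + k))
          (d := downs (i + 2 + k)) (T := [⟨downs i, .cross q false false, downs k⟩])
          (by simp [downs_split]) []).append_right (unsort (l ++ y :: x :: r))))
      have h4 := Eqv.append_left (isTangle_circles j) ((nest_cross q i k).append_right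
        (whisker [] (downs (i + 2 + k)) W ++ unsort (l ++ y :: x :: r)))
      have h5 := Span.base _ j _ hc.1 hc.2 (IsBraid.append (m := i + 2 + k)
        (show i + 2 + k = k + 2 + i by omega ▸ isBraid_singleton q k i) hW)
      simp at h3 h4 h5 ⊢
      exact (h5.iso h4.symm).iso h3.symm

end Span

end Spanning

/-! ### Braids modulo the skein relation: the last generator is needed at most once. -/

section Hecke

attribute [local simp] IsTangle Slice.src Slice.tgt Event.src Event.tgt whisker Slice.whisker
  sliceWhisker_comp

/-! ### Braids of upward strands -/

/-- The braids on `m + 1` strands that the skein relation reduces to braids in which the last two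
strands cross at most once. -/
inductive Reduced (m : ℕ) : List Slice → Prop
  | split (W : List Slice) : IsBraid m W → Reduced m (whisker [] [true] W)
  | once (k : ℕ) (p : Bool) (V W : List Slice) : k + 1 = m → IsBraid m V → IsBraid m W →
      Reduced m (whisker [] [true] V ++ ⟨ups k, .cross p true true, []⟩ :: whisker [] [true] W)
  | iso {S T : List Slice} : Eqv (ups (m + 1)) S T → Reduced m S → Reduced m T
  | skein (p : Bool) (A : List Slice) (l r : Strands) (B : List Slice) :
      Reduced m (A ++ ⟨l, .cross (!p) true true, r⟩ :: B) → Reduced m (A ++ B) →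
      Reduced m (A ++ ⟨l, .cross p true true, r⟩ :: B)

namespace Reduced

theorem append_braid {m : ℕ} {T Y : List Slice} (h : Reduced m T) (hY : IsBraid m Y) :
    Reduced m (T ++ whisker [] [true] Y) := by
  induction h with
  | split W hW => rw [← whisker_append]; exact .split _ (hW.append hY)
  | once k p V W hk hV hW =>
    have := Reduced.once k p V (W ++ Y) hk hV (hW.append hY)
    simpa using this
  | iso h _ ih => exact ih.iso (h.append_right _)
  | skein p A l r B _ _ ih ih' =>
    have := Reduced.skein (m := m) p A l r (B ++ whisker [] [true] Y) (by simpa using ih)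
      (by simpa using ih')
    simpa using this

theorem isTangle_braid {k : ℕ} {X : List Slice} (hX : IsBraid (k + 1) X) :
    IsTangle (ups (k + 2)) (whisker [] [true] X) (ups (k + 2)) := by
  simpa [ups_succ] using hX.isTangle.whisker [] [true]

/-- Opposite crossings cancel; for equal ones the skein relation changes one of them and leaves a
single crossing. This is the quadratic relation of the Hecke algebra. -/
theorem pair {k : ℕ} {X : List Slice} (hX : IsBraid (k + 1) X) (p p' : Bool) :
    Reduced (k + 1) (whisker [] [true] X ++
      [⟨ups k, .cross p true true, []⟩, ⟨ups k, .cross p' true true, []⟩]) := by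
  have cancel : Reduced (k + 1) (whisker [] [true] X ++
      [⟨ups k, .cross p true true, []⟩, ⟨ups k, .cross (!p) true true, []⟩]) := by
    refine iso (S := whisker [] [true] X) ?_ (.split _ hX)
    have := (Eqv.reidemeister_two p true true).context (a := ups (k + 2)) (whisker [] [true] X) []
      (ups k) [] (by simpa [ups_succ] using isTangle_braid hX)
    simpa using this.symm
  by_cases hp : p' = !p
  · rw [hp]; exact cancel
  · obtain rfl : p' = p := by cases p <;> cases p' <;> simp_all
    have := Reduced.skein (m := k + 1) p' (whisker [] [true] X ++ [⟨ups k, .cross p' true true, []⟩])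
      (ups k) [] [] (by simpa using cancel)
      (by simpa using Reduced.once k p' X [] rfl hX (by simp [IsBraid]))
    simpa using this

/-- If all three types agree, the braid relation moves the last generator to the middle, where it
occurs once. The skein relation makes the types agree; the smoothings that arise are covered by
`pair` or use the last generator once. -/
theorem triple {k : ℕ} {X : List Slice} (hX : IsBraid (k + 2) X) (p r p' : Bool) :
    Reduced (k + 2) (whisker [] [true] X ++ [⟨ups (k + 1), .cross p true true, []⟩,
      ⟨ups k, .cross r true true, [true]⟩, ⟨ups (k + 1), .cross p' true true, []⟩]) := by
  have hr : ∀ r, IsBraid (k + 2) [⟨ups k, .cross r true true, []⟩] := fun r => by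
    simpa using isBraid_singleton r k 0
  have h1 : Reduced (k + 2) (whisker [] [true] X ++ [⟨ups (k + 1), .cross p true true, []⟩,
      ⟨ups k, .cross p true true, [true]⟩, ⟨ups (k + 1), .cross p true true, []⟩]) := by
    have h := (Eqv.reidemeister_three p true true true).context (a := ups (k + 3))
      (whisker [] [true] X) [] (ups k) [] (by simpa [ups_succ] using isTangle_braid hX)
    have h' := Reduced.once (k + 1) p _ _ rfl (hX.append (hr p)) (hr p)
    refine h'.iso ?_
    simpa [ups_succ] using h
  have h2 : ∀ r, Reduced (k + 2) (whisker [] [true] X ++ [⟨ups (k + 1), .cross p true true, []⟩,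
      ⟨ups k, .cross r true true, [true]⟩, ⟨ups (k + 1), .cross p true true, []⟩]) := by
    intro r
    by_cases hrp : r = p
    · rw [hrp]; exact h1
    · obtain rfl : p = !r := by cases p <;> cases r <;> simp_all
      have := Reduced.skein (m := k + 2) r (whisker [] [true] X ++
        [⟨ups (k + 1), .cross (!r) true true, []⟩]) (ups k) [true]
        [⟨ups (k + 1), .cross (!r) true true, []⟩] (by simpa using h1)
        (by simpa using pair hX (!r) (!r))
      simpa using this
  by_cases hp : p' = p
  · rw [hp]; exact h2 r
  · obtain rfl : p = !p' := by cases p <;> cases p' <;> simp_all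
    have := Reduced.skein (m := k + 2) p' (whisker [] [true] X ++
      [⟨ups (k + 1), .cross (!p') true true, []⟩, ⟨ups k, .cross r true true, [true]⟩])
      (ups (k + 1)) [] [] (by simpa using h2 r)
      (by simpa using Reduced.once (k + 1) (!p') X _ rfl hX (hr r))
    simpa using this

theorem last_comm {k : ℕ} {U : List Slice} (hU : IsBraid k U) (p : Bool) :
    Eqv (ups (k + 2)) (⟨ups k, .cross p true true, []⟩ :: whisker [] [true, true] U)
      (whisker [] [true, true] U ++ [⟨ups k, .cross p true true, []⟩]) := by
  have := (Eqv.interchange hU.isTangle (c := [true, true]) (d := [true, true])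
    (T := [⟨[], .cross p true true, []⟩]) (by simp) []).symm
  simpa [ups_succ] using this

/-- In the Hecke algebra `H_{m+1} = H_m + H_m g_m H_m`, by induction on the number of strands and
the length of the word. Between two occurrences of `g_m` the word lies in `H_m` and is reduced by
induction: without `g_{m-1}` it commutes with `g_m` and `pair` applies; with a single `g_{m-1}`,
`triple` does. -/
theorem of_isBraid {m : ℕ} {W : List Slice} (hW : IsBraid (m + 1) W) : Reduced m W := by
  induction m generalizing W with
  | zero =>
    rcases W with _ | ⟨s, W⟩
    · exact .split [] (by simp [IsBraid])
    · obtain ⟨p, i, j, h, -⟩ := hW s List.mem_cons_self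
      omega
  | succ k ihm =>
    have last : ∀ (V W : List Slice) (p p' : Bool), IsBraid (k + 1) V → IsBraid (k + 1) W →
        Reduced (k + 1) (whisker [] [true] V ++ ⟨ups k, .cross p true true, []⟩ ::
          (whisker [] [true] W ++ [⟨ups k, .cross p' true true, []⟩])) := by
      intro V W p p' hV hW
      have hW' := ihm hW
      clear hW
      have hV' := isTangle_braid hV
      induction hW' with
      | split U hU =>
        refine (pair (hV.append hU.succ) p p').iso ?_
        have := Eqv.append_left hV' ((last_comm hU p).append_right
          [⟨ups k, .cross p' true true, []⟩])
        simpa using this.symm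
      | once k' r U Y hk hU hY =>
        subst hk
        refine ((triple (hV.append hU.succ) p r p').append_braid hY.succ).iso ?_
        have h1 := Eqv.append_left hV' ((last_comm hU p).append_right
          (⟨ups k', .cross r true true, [true]⟩ ::
            (whisker [] [true, true] Y ++ [⟨ups (k' + 1), .cross p' true true, []⟩])))
        have h2 := Eqv.append_left (c := ups (k' + 3)) (a := ups (k' + 3))
          (A := whisker [] [true] V ++ whisker [] [true, true] U ++
            [⟨ups (k' + 1), .cross p true true, []⟩, ⟨ups k', .cross r true true, [true]⟩])
          (IsTangle.append (b := ups (k' + 3))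
            (hV'.append (by simpa using isTangle_braid hU.succ)) (by simp [ups_succ]))
          (last_comm hY p').symm
        simp at h1 h2 ⊢
        exact (h1.trans h2).symm
      | iso h _ ih =>
        refine ih.iso ?_
        have := Eqv.append_left hV' (Eqv.append_left (c := ups (k + 2))
          (A := [⟨ups k, .cross p true true, []⟩]) (a := ups (k + 2)) (by simp [ups_succ])
          (by simpa [ups_succ] using
            (h.whisker [] [true]).append_right [⟨ups k, .cross p' true true, []⟩]))
        simpa using this
      | skein q A l r B _ _ ih ih' =>
        have := Reduced.skein (m := k + 1) q (whisker [] [true] V ++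
          ⟨ups k, .cross p true true, []⟩ :: whisker [] [true] A) l (r ++ [true])
          (whisker [] [true] B ++ [⟨ups k, .cross p' true true, []⟩]) (by simpa using ih)
          (by simpa using ih')
        simpa using this
    induction W using List.reverseRecOn with
    | nil => exact .split [] (by simp [IsBraid])
    | append_singleton W s ih =>
      have h := ih fun t ht => hW t (List.mem_append_left _ ht)
      obtain ⟨p, i, j, hij, rfl⟩ := hW s (by simp)
      clear ih hW
      rcases j with _ | j
      · obtain rfl : i = k := by omega
        induction h with
        | split W hW => simpa using Reduced.once i p W [] rfl hW (by simp [IsBraid])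
        | once k' r V W hk hV hW =>
          obtain rfl : k' = i := by omega
          simpa using last V W r p hV hW
        | iso h _ ih => exact ih.iso (h.append_right _)
        | skein q A l r B _ _ ih ih' =>
          have := Reduced.skein (m := i + 1) q A l r (B ++ [⟨ups i, .cross p true true, []⟩])
            (by simpa using ih) (by simpa using ih')
          simpa using this
      · have hs : IsBraid (k + 1) [⟨ups i, .cross p true true, ups j⟩] := by
          have := isBraid_singleton p i j
          rwa [show i + 2 + j = k + 1 by omega] at this
        simpa [ups_succ] using h.append_braid hs

end Reduced

end Hecke

/-! ### Maxima and minima on standard tangles. -/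

section Closure

attribute [local simp] IsTangle Slice.src Slice.tgt Event.src Event.tgt whisker Slice.whisker
  sliceWhisker_comp

/-! ### All tangles reduce to standard ones -/

theorem circle_left (l r : Strands) :
    Eqv (l ++ r) [⟨l, .cup true, r⟩, ⟨l, .cap true, r⟩]
      [⟨[], .cup true, l ++ r⟩, ⟨[], .cap true, l ++ r⟩] := by
  induction l with
  | nil => exact Eqv.refl _ _
  | cons x l ih =>
    have h1 := ih.whisker [x] []
    have h2 := (Eqv.circle_slide x).whisker [] (l ++ r)
    simp at h1 h2 ⊢
    exact h1.trans h2

theorem circle_bottom {l r : Strands} {A : List Slice} (hA : IsTangle [] A (l ++ r)) :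
    Eqv [] (A ++ [⟨l, .cup true, r⟩, ⟨l, .cap true, r⟩])
      ([⟨[], .cup true, []⟩, ⟨[], .cap true, []⟩] ++ A) := by
  have h1 := Eqv.append_left hA (circle_left l r)
  have h2 := Eqv.interchange (S := [⟨[], .cup true, []⟩, ⟨[], .cap true, []⟩]) (a := []) (b := [])
    (by simp) hA []
  have h3 : whisker [] [] A = A := List.map_id'' (fun s => by simp) A
  simp only [List.append_nil, List.nil_append, h3] at h2
  simp at h1 h2 ⊢
  exact h1.trans h2.symm

/-- A predicate on a place between strands that is invariant under exchanging neighbouring strands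
and under moving the place can be checked at the middle of a sorted row. -/
theorem sort_induction {P : Strands → Strands → Prop}
    (fwd : ∀ l y r, P l (y :: r) → P (l ++ [y]) r) (bwd : ∀ l y r, P (l ++ [y]) r → P l (y :: r))
    (swap : ∀ l x y r, P [] (l ++ x :: y :: r) → P [] (l ++ y :: x :: r))
    (base : ∀ m, P (ups m) (downs m)) {l r : Strands}
    (h : (l ++ r).count true = (l ++ r).count false) : P l r := by
  have hfwd : ∀ l s r, P s (l ++ r) → P (s ++ l) r := by
    intro l
    induction l with
    | nil => intro s r h; simpa using h
    | cons x l ih => intro s r h; simpa using ih (s ++ [x]) r (fwd _ _ _ h)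
  have hbwd : ∀ l s r, P (s ++ l) r → P s (l ++ r) := by
    intro l
    induction l with
    | nil => intro s r h; simpa using h
    | cons x l ih => intro s r h; exact bwd _ _ _ (ih (s ++ [x]) r (by simpa using h))
  -- The prefix `s` absorbs the strands that the permutation fixes on the left.
  have perm : ∀ a b : Strands, a.Perm b → ∀ s, P [] (s ++ a) → P [] (s ++ b) := by
    intro a b hab
    induction hab with
    | nil => exact fun s h => h
    | cons x _ ih => intro s h; simpa using ih (s ++ [x]) (by simpa using h)
    | swap x y l => exact fun s h => swap _ _ _ _ h
    | trans _ _ ih ih' => exact fun s h => ih' s (ih s h)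
  refine hfwd l [] r (perm (ups ((l ++ r).count true) ++ downs ((l ++ r).count false)) _ ?_ [] ?_)
  · refine List.perm_iff_count.2 fun b => ?_
    cases b <;> simp [List.count_replicate]
  · rw [h]
    exact hbwd (ups _) [] (downs _) (base _)

namespace Span

theorem count_eq {a : Strands} {T : List Slice} (h : Span a T) : a.count true = a.count false := by
  induction h with
  | base m j W h1 h2 _ => rw [h1, h2]
  | iso _ _ ih => exact ih
  | skein _ _ _ _ _ _ _ ih _ => exact ih

theorem sorted_base {m j : ℕ} {W : List Slice} (hW : IsBraid m W) :
    Span (ups m ++ downs m) (circles j ++ nest m ++ whisker [] (downs m) W) := by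
  have := Span.base (a := ups m ++ downs m) m j W (by simp [List.count_replicate])
    (by simp [List.count_replicate]) hW
  rwa [unsort_ups_downs, List.append_nil] at this

/-- The maximum closes the last strand of the braid, as in the Markov trace. If the strand is not
involved, a circle splits off and sinks to the bottom; if it crosses once, a curl arises and is
removed. -/
theorem sorted_cap_reduced {m : ℕ} (j : ℕ) {W : List Slice} (hW : Reduced m W) :
    Span (ups m ++ downs m) (circles j ++ nest (m + 1) ++ whisker [] (downs (m + 1)) W ++
      [⟨ups m, .cap true, downs m⟩]) := by
  have hN := (isTangle_circles j).append (isTangle_nest m)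
  have hN' := (isTangle_circles j).append (isTangle_nest (m + 1))
  have cap_comm : ∀ W, IsBraid m W → Eqv (ups m ++ ([true, false] ++ downs m))
      (whisker [] (true :: downs (m + 1)) W ++ [⟨ups m, .cap true, downs m⟩])
      (⟨ups m, .cap true, downs m⟩ :: whisker [] (downs m) W) := by
    intro W hW
    have := (Eqv.interchange hW.isTangle (c := [true, false] ++ downs m) (d := downs m)
      (T := [⟨[], .cap true, downs m⟩]) (by simp) [])
    simpa [downs_succ] using this
  induction hW with
  | split W hW =>
    refine (sorted_base (j := j + 1) hW).iso ?_
    have h1 := Eqv.append_left hN' (by simpa [ups_succ, downs_succ] using cap_comm W hW)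
    have h2 := (circle_bottom hN).append_right (whisker [] (downs m) W)
    simp [nest, circles, downs_succ] at h1 h2 ⊢
    exact (h1.trans h2).symm
  | once k p V W hk hV hW =>
    subst hk
    refine (sorted_base (j := j) (hV.append hW)).iso ?_
    have h1 := Eqv.append_left (A := circles j ++ nest (k + 2) ++ whisker [] (true :: downs (k + 2)) V
        ++ [⟨ups k, .cross p true true, downs (k + 2)⟩]) (a := ups (k + 1) ++ ([true, false] ++
          downs (k + 1)))
      (by
        refine (IsTangle.append hN' (c := ups (k + 1) ++ ([true, false] ++ downs (k + 1))) ?_).append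
          (by simp [ups_succ, downs_succ])
        simpa [downs_succ, ups_succ] using hV.isTangle.whisker [] (true :: downs (k + 2)))
      (cap_comm W hW)
    have h2 := (Eqv.interchange hV.isTangle (c := downs (k + 1))
      (d := [true, false] ++ downs (k + 1)) (T := [⟨[], .cup true, downs (k + 1)⟩]) (by simp) [])
    rw [List.append_nil] at h2
    have h3 := Eqv.append_left hN (h2.append_right (⟨ups k, .cross p true true, downs (k + 2)⟩ ::
      ⟨ups (k + 1), .cap true, downs (k + 1)⟩ :: whisker [] (downs (k + 1)) W))
    have h4 := (Eqv.curl p).context (a := []) (circles j ++ nest (k + 1) ++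
      whisker [] (downs (k + 1)) V) (whisker [] (downs (k + 1)) W) (ups k) (downs (k + 1))
      (hN.append (by simpa [ups_succ] using hV.isTangle.whisker [] (downs (k + 1))))
    simp [nest, downs_succ, ups_succ] at h1 h3 h4 ⊢
    exact (h1.trans (h3.symm.trans h4)).symm
  | iso h _ ih =>
    refine ih.iso ?_
    have := (Eqv.append_left hN' (h.whisker [] (downs (m + 1)))).append_right
      [⟨ups m, .cap true, downs m⟩]
    simpa using this
  | skein p A l r B _ _ ih ih' =>
    have := Span.skein (a := ups m ++ downs m) p (circles j ++ nest (m + 1) ++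
      whisker [] (downs (m + 1)) A) l (r ++ downs (m + 1)) (whisker [] (downs (m + 1)) B ++
        [⟨ups m, .cap true, downs m⟩]) (by simpa using ih) (by simpa using ih')
    simpa using this

theorem sorted_cap {m : ℕ} {T : List Slice} (h : Span (ups m ++ true :: false :: downs m) T) :
    Span (ups m ++ downs m) (T ++ [⟨ups m, .cap true, downs m⟩]) := by
  refine h.append_of_base fun n j W h1 h2 hW => ?_
  obtain rfl : m + 1 = n := by simpa [List.count_replicate] using h1
  have h3 : ups m ++ true :: false :: downs m = ups (m + 1) ++ downs (m + 1) := by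
    simp [ups_succ, downs_succ]
  rw [h3, unsort_ups_downs, List.append_nil]
  exact sorted_cap_reduced j (Reduced.of_isBraid hW)

theorem sorted_cup {m : ℕ} {T : List Slice} (h : Span (ups m ++ downs m) T) :
    Span (ups m ++ true :: false :: downs m) (T ++ [⟨ups m, .cup true, downs m⟩]) := by
  refine h.append_of_base fun n j W h1 h2 hW => ?_
  obtain rfl : m = n := by simpa [List.count_replicate] using h1
  rw [unsort_ups_downs, List.append_nil]
  have h3 : ups m ++ true :: false :: downs m = ups (m + 1) ++ downs (m + 1) := by
    simp [ups_succ, downs_succ]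
  rw [h3]
  refine (sorted_base (j := j) hW.succ).iso ?_
  have h4 := Eqv.append_left ((isTangle_circles j).append (isTangle_nest m))
    (by simpa using (Eqv.interchange hW.isTangle (c := downs m) (d := [true, false] ++ downs m)
      (T := [⟨[], .cup true, downs m⟩]) (by simp) []))
  simp [nest, downs_succ] at h4 ⊢
  exact h4.symm

/-- The place of a maximum. -/
def CapAt (l r : Strands) : Prop :=
  ∀ T, Span (l ++ true :: false :: r) T → Span (l ++ r) (T ++ [⟨l, .cap true, r⟩])

/-- A maximum in the middle of a sorted row is `sorted_cap`. It travels elsewhere by sliding past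
neighbouring strands, with the crossings chosen so that `Span.cross` applies; a swap of strands away
from it is undone by a second Reidemeister move. -/
theorem capAt_of_count_eq {l r : Strands} (h : (l ++ r).count true = (l ++ r).count false) :
    CapAt l r := by
  refine sort_induction (P := CapAt) ?_ ?_ ?_ (fun m T hT => sorted_cap hT) h
  · intro l y r h T hT
    have h1 := (by simpa using hT : Span (l ++ y :: true :: (false :: r)) T).cross (!y)
      (by cases y <;> simp)
    have h2 := (by simpa using h1 : Span ((l ++ [true]) ++ y :: false :: r) _).cross (!y)
      (by cases y <;> simp)
    have h3 := h _ (by simpa using h2)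
    have h4 := (Eqv.slide_cap (!y) true y).context (a := []) T [] l r (by simpa using hT.isTangle)
    simp at h3 h4 ⊢
    exact h3.iso h4
  · intro l y r h T hT
    have h1 := (by simpa using hT : Span ((l ++ [true]) ++ false :: y :: r) T).cross y
      (by cases y <;> simp)
    have h2 := (by simpa using h1 : Span (l ++ true :: y :: (false :: r)) _).cross y
      (by cases y <;> simp)
    have h3 := h _ (by simpa using h2)
    have h4 := (Eqv.slide_cap (!y) true y).context (a := []) (T ++
      [⟨l ++ [true], .cross y false y, r⟩, ⟨l, .cross y true y, false :: r⟩]) [] l r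
      (by simpa using h2.isTangle)
    have h5 := (Eqv.reidemeister_two y true y).context (a := []) (T ++
      [⟨l ++ [true], .cross y false y, r⟩]) [⟨l ++ [true], .cross (!y) y false, r⟩,
        ⟨l, .cap true, y :: r⟩] l (false :: r) (by simpa using h1.isTangle)
    have h6 := (Eqv.reidemeister_two y false y).context (a := []) T
      [⟨l, .cap true, y :: r⟩] (l ++ [true]) r (by simpa using hT.isTangle)
    simp at h3 h4 h5 h6 ⊢
    exact h3.iso (h4.symm.trans (h5.trans h6))
  · intro l x y r h T hT
    -- For opposite strands the choice `p = x = !y` puts the downward strand on top both in the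
    -- crossing and in its inverse.
    have h1 : ∃ p : Bool, (y = x ∨ p = !y) ∧ (x = y ∨ (!p) = !x) := by
      cases x <;> cases y <;> simp
    obtain ⟨p, hp, hp'⟩ := h1
    have h2 := (by simpa using hT : Span ((true :: false :: l) ++ y :: x :: r) T).cross p hp
    have h3 := (by simpa using h _ h2 : Span (l ++ x :: y :: r) _).cross (!p) hp'
    have h4 := (Eqv.slice_interchange (.cap true) (.cross (!p) x y) [] l r).context (a := [])
      (T ++ [⟨true :: false :: l, .cross p y x, r⟩]) [] [] [] (by simpa using h2.isTangle)
    have h5 := (Eqv.reidemeister_two p y x).context (a := []) T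
      [⟨[], .cap true, l ++ y :: x :: r⟩] (true :: false :: l) r (by simpa using hT.isTangle)
    simp at h3 h4 h5 ⊢
    exact h3.iso (h4.trans h5)

/-- The place of a minimum. -/
def CupAt (l r : Strands) : Prop :=
  ∀ T, Span (l ++ r) T → Span (l ++ true :: false :: r) (T ++ [⟨l, .cup true, r⟩])

theorem cupAt_of_count_eq {l r : Strands} (h : (l ++ r).count true = (l ++ r).count false) :
    CupAt l r := by
  refine sort_induction (P := CupAt) ?_ ?_ ?_ (fun m T hT => sorted_cup hT) h
  · intro l y r h T hT
    have h0 := h T (by simpa using hT)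
    have h1 := (by simpa using h0 : Span ((l ++ [true]) ++ false :: y :: r) _).cross y
      (by cases y <;> simp)
    have h2 := (by simpa using h1 : Span (l ++ true :: y :: (false :: r)) _).cross y
      (by cases y <;> simp)
    have h4 := (Eqv.slide_cup y true y).context (a := []) T [] l r (by simpa using hT.isTangle)
    simp at h2 h4 ⊢
    exact h2.iso h4
  · intro l y r h T hT
    have h0 := h T (by simpa using hT)
    have h1 := (by simpa using h0 : Span (l ++ y :: true :: (false :: r)) _).cross (!y)
      (by cases y <;> simp)
    have h2 := (by simpa using h1 : Span ((l ++ [true]) ++ y :: false :: r) _).cross (!y)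
      (by cases y <;> simp)
    have h4 := (Eqv.slide_cup y true y).context (a := []) T
      [⟨l, .cross (!y) y true, false :: r⟩, ⟨l ++ [true], .cross (!y) y false, r⟩] l r
      (by simpa using hT.isTangle)
    have h5 := (Eqv.reidemeister_two y true y).context (a := []) (T ++
      [⟨l, .cup true, y :: r⟩, ⟨l ++ [true], .cross y false y, r⟩])
      [⟨l ++ [true], .cross (!y) y false, r⟩] l (false :: r)
      (by
        have := hT.isTangle.append (T := [⟨l, .cup true, y :: r⟩,
          ⟨l ++ [true], .cross y false y, r⟩]) (c := l ++ [true, y, false] ++ r) (by simp)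
        simpa using this)
    have h6 := (Eqv.reidemeister_two y false y).context (a := []) (T ++
      [⟨l, .cup true, y :: r⟩]) [] (l ++ [true]) r
      (by
        have := hT.isTangle.append (T := [⟨l, .cup true, y :: r⟩])
          (c := l ++ [true, false, y] ++ r) (by simp)
        simpa using this)
    simp at h2 h4 h5 h6 ⊢
    exact h2.iso (h4.symm.trans (h5.trans h6))
  · intro l x y r h T hT
    have h1 : ∃ p : Bool, (y = x ∨ p = !y) ∧ (x = y ∨ (!p) = !x) := by
      cases x <;> cases y <;> simp
    obtain ⟨p, hp, hp'⟩ := h1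
    have h2 := (by simpa using hT : Span (l ++ y :: x :: r) T).cross p hp
    have h3 := (by simpa using h _ h2 :
      Span ((true :: false :: l) ++ x :: y :: r) _).cross (!p) hp'
    have h4 := (Eqv.slice_interchange (.cup true) (.cross (!p) x y) [] l r).context (a := [])
      (T ++ [⟨l, .cross p y x, r⟩]) [] [] [] (by simpa using h2.isTangle)
    have h5 := (Eqv.reidemeister_two p y x).context (a := []) T
      [⟨[], .cup true, l ++ y :: x :: r⟩] l r (by simpa using hT.isTangle)
    simp at h3 h4 h5 ⊢
    exact h3.iso (h4.trans h5)

end Span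

end Closure

/-! ### Every tangle reduces to standard ones; uniqueness of the Conway polynomial. -/

section Uniqueness

attribute [local simp] IsTangle Slice.src Slice.tgt Event.src Event.tgt whisker Slice.whisker
  sliceWhisker_comp

namespace Span

theorem cap {l r : Strands} {x : Bool} {T : List Slice} (h : Span (l ++ x :: (!x) :: r) T) :
    Span (l ++ r) (T ++ [⟨l, .cap x, r⟩]) := by
  have hc := h.count_eq
  have hc' : (l ++ r).count true = (l ++ r).count false := by
    cases x <;> simp [List.count_append] at hc ⊢ <;> omega
  cases x
  · have h1 := capAt_of_count_eq hc' _ (h.cross true (.inr rfl))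
    have h2 := (Eqv.reidemeister_one_cap true false).context (a := []) T [] l r
      (by simpa using h.isTangle)
    simp at h1 h2 ⊢
    exact h1.iso h2
  · exact capAt_of_count_eq hc' T h

theorem cup {l r : Strands} (x : Bool) {T : List Slice} (h : Span (l ++ r) T) :
    Span (l ++ x :: (!x) :: r) (T ++ [⟨l, .cup x, r⟩]) := by
  have h1 := cupAt_of_count_eq h.count_eq T h
  cases x
  · have h2 := (Eqv.reidemeister_one_cup false true).context (a := []) T [] l r
      (by simpa using h.isTangle)
    have h3 := h1.cross false (.inr rfl)
    simp at h2 h3 ⊢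
    exact h3.iso h2
  · exact h1

/-- Here the upward strand is on top, the case that `Span.cross` excludes. A quarter turn makes it a
crossing of upward strands; there the skein relation leads to the opposite crossing, already
treated, and to a maximum followed by a minimum. -/
theorem cross_left_right {l r : Strands} {T : List Slice} (h : Span (l ++ true :: false :: r) T) :
    Span (l ++ false :: true :: r) (T ++ [⟨l, .cross true true false, r⟩]) := by
  have h1 : ∀ p, Eqv [] (T ++ [⟨l, .cup false, true :: false :: r⟩,
      ⟨l ++ [false], .cross p true true, false :: r⟩, ⟨l ++ [false, true], .cap true, r⟩])
      (T ++ [⟨l, .cross (!p) true false, r⟩]) := by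
    intro p
    have := (Eqv.rotate_cross_left p).context (a := []) T [] l r (by simpa using h.isTangle)
    simpa using this
  have h2 : Eqv [] (T ++ [⟨l, .cup false, true :: false :: r⟩, ⟨l ++ [false, true], .cap true, r⟩])
      (T ++ [⟨l, .cap true, r⟩, ⟨l, .cup false, r⟩]) := by
    have := (Eqv.slice_interchange (.cup false) (.cap true) [] [] []).context (a := []) T []
      l r (by simpa using h.isTangle)
    simpa using this
  have h3 := ((cap (x := true) h).cup false).iso (by simpa using h2.symm)
  have h4 := (h.cross false (.inr rfl)).iso (h1 true).symm
  have h5 := Span.skein (a := l ++ false :: true :: r) false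
    (T ++ [⟨l, .cup false, true :: false :: r⟩]) (l ++ [false]) (false :: r)
    [⟨l ++ [false, true], .cap true, r⟩] (by simpa using h4) (by simpa using h3)
  exact (by simpa using h5 : Span _ _).iso (h1 false)

theorem cross_right_left {l r : Strands} {T : List Slice} (h : Span (l ++ false :: true :: r) T) :
    Span (l ++ true :: false :: r) (T ++ [⟨l, .cross false false true, r⟩]) := by
  have h1 : ∀ p, Eqv [] (T ++ [⟨l ++ [false, true], .cup true, r⟩,
      ⟨l ++ [false], .cross p true true, false :: r⟩, ⟨l, .cap false, true :: false :: r⟩])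
      (T ++ [⟨l, .cross (!p) false true, r⟩]) := by
    intro p
    have := (Eqv.rotate_cross_right p).context (a := []) T [] l r (by simpa using h.isTangle)
    simpa using this
  have h2 : Eqv [] (T ++ [⟨l, .cap false, r⟩, ⟨l, .cup true, r⟩])
      (T ++ [⟨l ++ [false, true], .cup true, r⟩, ⟨l, .cap false, true :: false :: r⟩]) := by
    have := (Eqv.slice_interchange (.cap false) (.cup true) [] [] []).context (a := []) T []
      l r (by simpa using h.isTangle)
    simpa using this
  have h3 := ((cap (x := false) h).cup true).iso (by simpa using h2)
  have h4 := (h.cross true (.inr rfl)).iso (h1 false).symm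
  have h5 := Span.skein (a := l ++ true :: false :: r) true
    (T ++ [⟨l ++ [false, true], .cup true, r⟩]) (l ++ [false]) (false :: r)
    [⟨l, .cap false, true :: false :: r⟩] (by simpa using h4) (by simpa using h3)
  exact (by simpa using h5 : Span _ _).iso (h1 true)

theorem of_isTangle {a : Strands} {T : List Slice} (h : IsTangle [] T a) : Span a T := by
  induction T using List.reverseRecOn generalizing a with
  | nil =>
    cases h
    have := Span.base (a := []) 0 0 [] rfl rfl (by simp [IsBraid])
    simpa [circles, nest, unsort] using this
  | append_singleton T s ih =>
    obtain ⟨b, hT, rfl, rfl⟩ := isTangle_append_iff.1 h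
    have hs := ih hT
    obtain ⟨l, e, r⟩ := s
    rcases e with x | x | ⟨p, x, y⟩
    · simpa using Span.cup (l := l) (r := r) x (by simpa using hs)
    · simpa using Span.cap (l := l) (r := r) (x := x) (by simpa using hs)
    · have hs' : Span (l ++ x :: y :: r) T := by simpa using hs
      simp only [Slice.tgt, Event.tgt, List.append_assoc, List.cons_append, List.nil_append]
      by_cases hp : x = y ∨ p = !x
      · exact hs'.cross p hp
      · cases x <;> cases y <;> cases p <;> simp at hp
        · exact hs'.cross_right_left
        · exact hs'.cross_left_right

end Span

/-! ### Induction over links by the skein relation -/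

theorem LinkDiagram.ext {D D' : LinkDiagram} (h : D.slices = D'.slices) : D = D' := by
  cases D; cases D'; simpa using h

/-- A move whose result is empty needs strands to act on, so it cannot consume a whole closed
diagram. Links being non-empty, this is needed to keep isotopies within link diagrams. -/
theorem TangleStep.ne_nil {S T : List Slice} (h : TangleStep [] S T) : S ≠ [] ∧ T ≠ [] := by
  obtain ⟨A, B, M, M', l, r, c, hM, hc, rfl, rfl⟩ := h
  obtain ⟨d, hA, hM'⟩ := isTangle_append_iff.1 hc
  obtain ⟨a₀, b₀, rfl, rfl, h3, -, -⟩ := hM.isTangle_whisker hM'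
  constructor
  · obtain ⟨s, M₁, b, rfl, -⟩ := hM.isTangle
    simp
  · intro h
    simp only [whisker, List.append_eq_nil_iff, List.map_eq_nil_iff] at h
    obtain ⟨⟨rfl, rfl⟩, rfl⟩ := h
    have h4 : [] = l ++ a₀ ++ r := hA
    obtain rfl : a₀ = [] := by simp at h4; exact h4.2.1
    cases hM <;> simp at h3

theorem Eqv.ne_nil_iff {S T : List Slice} (h : Eqv [] S T) : S ≠ [] ↔ T ≠ [] := by
  induction h with
  | rel S T h => exact iff_of_true h.ne_nil.1 h.ne_nil.2
  | refl S => rfl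
  | symm S T _ ih => exact ih.symm
  | trans S T U _ _ ih ih' => exact ih.trans ih'

theorem Eqv.toLink_eq {S T : List Slice} (h : Eqv [] S T) {D D' : LinkDiagram}
    (hD : D.slices = S) (hD' : D'.slices = T) : D.toLink = D'.toLink := by
  induction h generalizing D D' with
  | rel S T h =>
    obtain ⟨A, B, M, M', l, r, c, hM, hc, rfl, rfl⟩ := h
    exact Quot.sound ⟨A, B, M, M', l, r, hM, hD, hD'⟩
  | refl S => rw [LinkDiagram.ext (hD.trans hD'.symm)]
  | symm S T _ ih => exact (ih hD' hD).symm
  | trans S T U h _ ih ih' =>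
    -- The intermediate stack must itself be a link diagram before the two equalities of links can
    -- be composed.
    have h1 : IsTangle [] T [] := (isTangle_iff h).1 (hD ▸ D.isTangle)
    have h2 : T ≠ [] := (ne_nil_iff h).1 (hD ▸ D.ne_nil)
    exact (ih (D' := ⟨T, h1, h2⟩) hD rfl).trans (ih' rfl hD')

/-- The trivial link with `j + 1` components. -/
def unlinkDiagram (j : ℕ) : LinkDiagram := ⟨circles (j + 1), isTangle_circles _, by simp [circles]⟩

/-- A property of links can be checked with the help of the skein relation. -/
theorem Link.skein_induction {P : Link → Prop} (hu : ∀ j, P (unlinkDiagram j).toLink)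
    (hs : ∀ Dp Dm D0 : LinkDiagram, IsSkeinTriple Dp Dm D0 → P D0.toLink →
      (P Dp.toLink ↔ P Dm.toLink)) (L : Link) : P L := by
  have key : ∀ T, Span [] T → ∀ D : LinkDiagram, D.slices = T → P D.toLink := by
    intro T hT
    induction hT with
    | base m j W h1 h2 hW =>
      intro D hD
      obtain rfl : 0 = m := h1
      obtain rfl : W = [] := by
        rcases W with _ | ⟨s, W⟩
        · rfl
        · obtain ⟨p, i, j, h, -⟩ := hW s List.mem_cons_self
          omega
      simp only [nest, unsort, whisker, List.map_nil, List.append_nil] at hD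
      rcases j with _ | j
      · exact absurd hD D.ne_nil
      · rw [LinkDiagram.ext (D' := unlinkDiagram j) hD]
        exact hu j
    | @iso S T h hS ih =>
      intro D hD
      have h2 : S ≠ [] := h.ne_nil_iff.2 (hD ▸ D.ne_nil)
      rw [← h.toLink_eq (D := ⟨S, hS.isTangle, h2⟩) rfl hD]
      exact ih _ rfl
    | skein p A l r B h h' ih ih' =>
      intro D hD
      -- The smoothing is again a non-empty link: a single crossing alone is not a closed diagram.
      have hA : A ++ B ≠ [] := by
        intro h0
        obtain ⟨rfl, rfl⟩ := List.append_eq_nil_iff.1 h0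
        have := h.isTangle
        simp at this
      have h1 := ih ⟨_, h.isTangle, by simp⟩ rfl
      have h2 := ih' ⟨_, h'.isTangle, hA⟩ rfl
      cases p
      · exact (hs _ D _ ⟨A, B, l, r, by simp, by simp [hD], rfl⟩ h2).1 h1
      · exact (hs D _ _ ⟨A, B, l, r, by simp [hD], by simp, rfl⟩ h2).2 h1
  obtain ⟨D, rfl⟩ := Quot.exists_rep L
  exact key _ (Span.of_isTangle D.isTangle) D rfl

theorem circle_reverse : Eqv [] [⟨[], .cup false, []⟩, ⟨[], .cap false, []⟩]
    [⟨[], .cup true, []⟩, ⟨[], .cap true, []⟩] := by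
  have h1 := (Eqv.reidemeister_one_cap true false).context (a := []) [⟨[], .cup false, []⟩] []
    [] [] (by simp)
  have h2 := (Eqv.reidemeister_one_cup true false).context (a := []) [] [⟨[], .cap true, []⟩]
    [] [] (by simp)
  simp at h1 h2
  exact h1.symm.trans h2

/-- A figure eight is a twisted circle for either type of its crossing, and its smoothing consists
of two circles; `j` further circles are carried along. The skein relation then gives `z ∇ = 0` on
the unlink with `j + 2` components. -/
theorem exists_skein_triple_unlink (j : ℕ) : ∃ Dp Dm D0 : LinkDiagram, IsSkeinTriple Dp Dm D0 ∧
    Dp.toLink = (unlinkDiagram j).toLink ∧ Dm.toLink = (unlinkDiagram j).toLink ∧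
    D0.toLink = (unlinkDiagram (j + 1)).toLink := by
  let A : List Slice := [⟨[], .cup false, []⟩, ⟨[false, true], .cup true, []⟩]
  let B : List Slice := [⟨[], .cap false, [true, false]⟩, ⟨[], .cap true, []⟩] ++ circles j
  let X : Bool → List Slice := fun p => A ++ [⟨[false], .cross p true true, [false]⟩] ++ B
  have hX : ∀ p, IsTangle [] (X p) [] := fun p => by
    simpa [X, A, B] using isTangle_circles j
  have h0 : IsTangle [] (A ++ B) [] := by simpa [A, B] using isTangle_circles j
  have hE : ∀ p, Eqv [] (X p) (circles (j + 1)) := by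
    intro p
    have h1 := (Eqv.rotate_cross_right p).context (a := []) [⟨[], .cup false, []⟩]
      (⟨[], .cap true, []⟩ :: circles j) [] [] (by simp)
    have h2 := (Eqv.reidemeister_one_cap (!p) false).context (a := []) [⟨[], .cup false, []⟩]
      (circles j) [] [] (by simp)
    have h3 := circle_reverse.append_right (circles j)
    simp [X, A, B, circles] at h1 h2 h3 ⊢
    exact h1.trans (h2.trans h3)
  have hE0 : Eqv [] (A ++ B) (circles (j + 2)) := by
    have h1 := (Eqv.slice_interchange (.cap false) (.cup true) [] [] []).context (a := [])
      [⟨[], .cup false, []⟩] (⟨[], .cap true, []⟩ :: circles j) [] [] (by simp)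
    have h2 := circle_reverse.append_right (circles (j + 1))
    simp [A, B, circles] at h1 h2 ⊢
    exact h1.symm.trans h2
  exact ⟨⟨X true, hX _, by simp [X]⟩, ⟨X false, hX _, by simp [X]⟩, ⟨A ++ B, h0, by simp [A]⟩,
    ⟨A, B, [false], [false], rfl, rfl, rfl⟩, (hE _).toLink_eq rfl rfl, (hE _).toLink_eq rfl rfl,
    hE0.toLink_eq rfl rfl⟩

theorem IsConwayPolynomial.unlink {nabla : Link → Polynomial ℤ} (h : IsConwayPolynomial nabla)
    (j : ℕ) : nabla (unlinkDiagram (j + 1)).toLink = 0 := by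
  obtain ⟨Dp, Dm, D0, hD, hp, hm, h0⟩ := exists_skein_triple_unlink j
  have := h.2 _ _ _ hD
  rw [hp, hm, h0] at this
  simpa using this

theorem IsConwayPolynomial.unique {f g : Link → Polynomial ℤ} (hf : IsConwayPolynomial f)
    (hg : IsConwayPolynomial g) : f = g := by
  funext L
  refine Link.skein_induction (P := fun L => f L = g L) (fun j => ?_) (fun Dp Dm D0 h h0 => ?_) L
  · rcases j with _ | j
    · exact hf.1.trans hg.1.symm
    · rw [hf.unlink, hg.unlink]
  · rw [hf.2 _ _ _ h, hg.2 _ _ _ h, h0]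
    exact add_left_inj _

end Uniqueness

/-! ### Multiplicativity, parity, and the constant coefficient. -/

section Final

/-! ### The state sum takes values in `ℤ[z]` and is multiplicative -/

theorem Link.stateSum_skein {Dp Dm D0 : LinkDiagram} (h : IsSkeinTriple Dp Dm D0) :
    Dp.toLink.stateSum = Dm.toLink.stateSum +
      algebraMap (Polynomial ℤ) SkeinRing Polynomial.X * D0.toLink.stateSum := by
  rw [← SkeinRing.q_sub_qi]
  exact KnotTheory.stateSum_skein SkeinRing.q SkeinRing.qi h

/-- The `q`-coordinate obeys the linear skein relation and vanishes on unlinks. This is what makes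
`re` multiplicative on state sums, which in general it is not. -/
theorem Link.im_stateSum (L : Link) : L.stateSum.im = 0 := by
  refine Link.skein_induction (P := fun L => L.stateSum.im = 0) (fun j => ?_)
    (fun Dp Dm D0 h h0 => ?_) L
  · rcases j with _ | j
    · have h : (unlinkDiagram 0).toLink.stateSum = 1 := stateSum_unknot
      rw [h, QuadraticAlgebra.im_one]
    · obtain ⟨Dp, Dm, D0, hD, hp, hm, h0⟩ := exists_skein_triple_unlink j
      have h1 := congrArg QuadraticAlgebra.im (Link.stateSum_skein hD)
      rw [hp, hm, h0] at h1
      simpa using h1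
  · rw [Link.stateSum_skein h]
    simp [h0]

theorem pull_whisker_right {R : Type*} [CommRing R] (q qi : R) (r : Strands) (T : List Slice)
    (Φ : List Bool → R) : pull q qi (whisker [] r T) Φ = pull q qi T Φ := by
  induction T with
  | nil => rfl
  | cons s T ih => rw [pull, ← ih]; rfl

theorem shiftOp_append_right {R : Type*} [CommRing R] (q qi : R) (e : Event) (n : ℕ)
    (Φ : List Bool → R) (σ τ : List Bool) (h : n + e.src.length ≤ σ.length) :
    shiftOp (eventOp q qi e) n Φ (σ ++ τ) =
      shiftOp (eventOp q qi e) n (fun ρ => Φ (ρ ++ τ)) σ := by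
  induction n generalizing Φ σ with
  | zero =>
    rcases e with x | x | ⟨p, x, y⟩
    · rfl
    · rcases σ with _ | ⟨b, _ | ⟨c, σ⟩⟩
      · simp [Event.src] at h
      · simp [Event.src] at h
      · rfl
    · rcases σ with _ | ⟨b, _ | ⟨c, σ⟩⟩
      · simp [Event.src] at h
      · simp [Event.src] at h
      · rfl
  | succ n ih =>
    rcases σ with _ | ⟨b, σ⟩
    · simp at h
    · exact ih _ σ (by simp at h; omega)

theorem pull_append_right {R : Type*} [CommRing R] (q qi : R) {a b : Strands} {T : List Slice}
    (hT : IsTangle a T b) (Φ : List Bool → R) (σ τ : List Bool) (h : σ.length = a.length) :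
    pull q qi T Φ (σ ++ τ) = pull q qi T (fun ρ => Φ (ρ ++ τ)) σ := by
  induction T generalizing a σ with
  | nil => rfl
  | cons s T ih =>
    obtain ⟨rfl, hT⟩ := hT
    rw [pull, shiftOp_append_right _ _ _ _ _ _ _ (by rw [h]; simp [Slice.src])]
    refine shiftOp_congr q qi s.event s.left s.right (charge _ σ) _ _ (fun ρ hρ => ?_) σ
      ⟨by simpa [Slice.src] using h, rfl⟩
    exact ih hT ρ (by simpa [Slice.tgt] using hρ.1)

/-- On one upward strand the charge-zero part has a single label; hence a long diagram acts on it by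
a scalar. -/
theorem eq_of_hasCharge {σ : List Bool} (h : HasCharge [true] 0 σ) : σ = [false] := by
  obtain ⟨h1, h2⟩ := h
  obtain ⟨b, rfl⟩ := List.length_eq_one_iff.1 h1
  cases b
  · rfl
  · simp [charge] at h2

theorem hasCharge_false : HasCharge [true] 0 [false] := ⟨rfl, rfl⟩

/-- The lowest minimum of the closure belongs to the closing arc, so the cut is made there. The arc
keeps the label `false` and the other end returns to `false` by its charge, which leaves the scalar
of the long diagram. -/
theorem stateSum_closure {R : Type*} [CommRing R] (q qi : R) (T : LongDiagram) :
    stateSum q qi T.closure.slices = pull q qi T.1 (fun _ => 1) [false] := by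
  have h1 : stateSum q qi T.closure.slices =
      pull q qi T.1 (pull q qi [⟨[], .cap true, []⟩] emptyLabels) ([false] ++ [false]) := by
    show 1 * pull q qi (whisker [] [false] T.1 ++ [⟨[], .cap true, []⟩]) emptyLabels _ = _
    rw [one_mul, pull_append, pull_whisker_right]
    rfl
  rw [h1, pull_append_right q qi T.2 _ [false] [false] rfl]
  refine pull_congr q qi T.2 0 _ _ (fun σ hσ => ?_) _ hasCharge_false
  rw [eq_of_hasCharge hσ]
  simp [pull, shiftOp, eventOp, capWeight, emptyLabels]

theorem stateSum_comp {R : Type*} [CommRing R] (q qi : R) (S T : LongDiagram) :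
    stateSum q qi (S.comp T).closure.slices =
      stateSum q qi S.closure.slices * stateSum q qi T.closure.slices := by
  simp only [stateSum_closure]
  show pull q qi (S.1 ++ T.1) _ _ = _
  -- On charge zero the inner function is constant; it is written as a linear combination so that
  -- `pull_linear` extracts the scalar.
  rw [pull_append, pull_congr q qi S.2 0 _ (fun _ => pull q qi T.1 (fun _ => 1) [false] * 1 + 0 * 1)
    (fun σ hσ => by rw [eq_of_hasCharge hσ]; ring) _ hasCharge_false, pull_linear]
  ring

theorem stateSum_connectedSum {K₁ K₂ K : Knot} (h : IsConnectedSum K₁ K₂ K) :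
    K.1.stateSum.re = K₁.1.stateSum.re * K₂.1.stateSum.re := by
  obtain ⟨S, T, h1, h2, h3⟩ := h
  have h4 : K.1.stateSum = K₁.1.stateSum * K₂.1.stateSum := by
    rw [← h1, ← h2, ← h3]
    exact stateSum_comp _ _ S T
  rw [h4, QuadraticAlgebra.re_mul, Link.im_stateSum]
  simp

/-! ### The parity of the number of components -/

/-- A sign for every event. -/
def Event.sign : Event → ℤ
  | .cup x => if x then -1 else 1
  | .cap x => if x then 1 else -1
  | .cross _ _ _ => -1

/-- The sign `(-1) ^ c` of a diagram, where `c` is the number of components. -/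
def diagramSign (D : List Slice) : ℤ := (D.map fun s => s.event.sign).prod

theorem diagramSign_whisker (l r : Strands) (D : List Slice) :
    diagramSign (whisker l r D) = diagramSign D := by
  simp [diagramSign, whisker, Slice.whisker, Function.comp_def]

theorem diagramSign_step {D D' : LinkDiagram} (h : D.Step D') :
    diagramSign D.slices = diagramSign D'.slices := by
  obtain ⟨A, B, M, M', l, r, hM, hD, hD'⟩ := h
  have key : diagramSign M = diagramSign M' := by
    cases hM with
    | interchange g h m => simp [diagramSign, mul_comm]
    | zigzag_left x => cases x <;> simp [diagramSign, Event.sign]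
    | zigzag_right x => cases x <;> simp [diagramSign, Event.sign]
    | slide_cap p x y => simp [diagramSign, Event.sign]
    | slide_cup p x y => simp [diagramSign, Event.sign]
    | reidemeister_one_cap p x => cases x <;> simp [diagramSign, Event.sign]
    | reidemeister_one_cup p x => cases x <;> simp [diagramSign, Event.sign]
    | reidemeister_two p x y => simp [diagramSign, Event.sign]
    | reidemeister_three p x y z => simp [diagramSign, Event.sign]
  have mul : ∀ S T, diagramSign (S ++ T) = diagramSign S * diagramSign T := fun S T => by
    simp [diagramSign]
  rw [hD, hD']
  simp only [mul, diagramSign_whisker, key]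

/-- The sign `(-1) ^ c` of a link, where `c` is the number of components. -/
def Link.sign (L : Link) : ℤ :=
  Quot.lift (fun D : LinkDiagram => diagramSign D.slices) (fun _ _ h => diagramSign_step h) L

-- The two sides agree by uniqueness: replacing `z` by `-z` changes the sign of the skein term, and
-- the smoothing has the sign opposite to that of both crossed diagrams. Only this behaviour of
-- `Link.sign` and its value on the unknot enter.
open Polynomial in
theorem IsConwayPolynomial.comp_neg_X {nabla : Link → ℤ[X]} (h : IsConwayPolynomial nabla)
    (L : Link) : C (-L.sign) * (nabla L).comp (-X) = nabla L := by
  have h' : IsConwayPolynomial fun L => C (-L.sign) * (nabla L).comp (-X) := by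
    refine ⟨?_, fun Dp Dm D0 hD => ?_⟩
    · have : Link.sign Knot.unknot.1 = -1 := by
        show diagramSign unknotDiagram.slices = -1
        simp [diagramSign, unknotDiagram, Event.sign]
      simp [h.1, this]
    · have h1 : Dp.toLink.sign = -D0.toLink.sign ∧ Dm.toLink.sign = -D0.toLink.sign := by
        obtain ⟨A, B, l, r, hp, hm, h0⟩ := hD
        constructor
        · show diagramSign Dp.slices = -diagramSign D0.slices
          rw [hp, h0]; simp [diagramSign, Event.sign]
        · show diagramSign Dm.slices = -diagramSign D0.slices
          rw [hm, h0]; simp [diagramSign, Event.sign]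
      simp only [h.2 _ _ _ hD, h1.1, h1.2, add_comp, mul_comp, X_comp, neg_neg, C_neg]
      ring
  exact congrFun (h'.unique h) L

/-! ### The constant coefficient for knots -/

theorem map_cupWeight {R S : Type*} [CommRing R] [CommRing S] (f : R →+* S) (q : R) (x b : Bool) :
    f (cupWeight q x b) = cupWeight (f q) x b := by
  cases x <;> cases b <;> simp [cupWeight]

theorem map_capWeight {R S : Type*} [CommRing R] [CommRing S] (f : R →+* S) (qi : R) (x b : Bool) :
    f (capWeight qi x b) = capWeight (f qi) x b := by
  cases x <;> cases b <;> simp [capWeight]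

theorem map_passWeight {R S : Type*} [CommRing R] [CommRing S] (f : R →+* S) (q qi : R)
    (p x y b c : Bool) : f (passWeight q qi p x y b c) = passWeight (f q) (f qi) p x y b c := by
  unfold passWeight
  split_ifs
  · generalize (p == (x == y)) = s
    cases s <;> cases b <;> simp
  · simp

theorem map_turnWeight {R S : Type*} [CommRing R] [CommRing S] (f : R →+* S) (q qi : R)
    (p x y b c : Bool) : f (turnWeight q qi p x y b c) = turnWeight (f q) (f qi) p x y b c := by
  unfold turnWeight
  split_ifs <;> simp

theorem map_shiftOp {R S : Type*} [CommRing R] [CommRing S] (f : R →+* S) (q qi : R) (e : Event)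
    (n : ℕ) (Φ : List Bool → R) (σ : List Bool) :
    f (shiftOp (eventOp q qi e) n Φ σ) =
      shiftOp (eventOp (f q) (f qi) e) n (fun τ => f (Φ τ)) σ := by
  induction n generalizing Φ σ with
  | zero =>
    rcases e with x | x | ⟨p, x, y⟩
    · simp [shiftOp, eventOp, map_cupWeight]
    · rcases σ with _ | ⟨b, _ | ⟨c, σ⟩⟩
      · simp [shiftOp, eventOp]
      · simp [shiftOp, eventOp]
      · simp only [shiftOp, eventOp]
        split_ifs <;> simp [map_capWeight]
    · rcases σ with _ | ⟨b, _ | ⟨c, σ⟩⟩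
      · simp [shiftOp, eventOp]
      · simp [shiftOp, eventOp]
      · simp only [shiftOp, eventOp, map_add, map_mul, map_passWeight, map_turnWeight]
  | succ n ih =>
    rcases σ with _ | ⟨b, σ⟩
    · simp [shiftOp]
    · exact ih _ σ

theorem map_pull {R S : Type*} [CommRing R] [CommRing S] (f : R →+* S) (q qi : R)
    (T : List Slice) (σ : List Bool) :
    f (pull q qi T emptyLabels σ) = pull (f q) (f qi) T emptyLabels σ := by
  induction T generalizing σ with
  | nil => simp only [pull, emptyLabels]; split_ifs <;> simp
  | cons s T ih => simp only [pull, map_shiftOp, ih]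

theorem map_stateSum {R S : Type*} [CommRing R] [CommRing S] (f : R →+* S) (q qi : R)
    (D : List Slice) : f (stateSum q qi D) = stateSum (f q) (f qi) D := by
  unfold stateSum
  split
  · rw [map_mul, map_pull]
    congr 1
    split_ifs <;> simp
  · simp

/-- Evaluation of the skein ring at `z = 0` and `q = 1`. -/
noncomputable def SkeinRing.evalOne : SkeinRing →+* ℤ where
  toFun x := x.re.coeff 0 + x.im.coeff 0
  map_one' := by simp [QuadraticAlgebra.re_one, QuadraticAlgebra.im_one]
  map_zero' := by simp
  map_add' x y := by simp; ring
  map_mul' x y := by simp [Polynomial.mul_coeff_zero]; ring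

/-- At `z = 0` the equation `q² = 1 + zq` admits `q = 1`; since the `q`-coordinate vanishes,
evaluating there yields the constant coefficient. -/
theorem Link.coeff_zero_stateSum (D : LinkDiagram) :
    D.toLink.stateSum.re.coeff 0 = KnotTheory.stateSum (1 : ℤ) 1 D.slices := by
  have h1 : SkeinRing.evalOne D.toLink.stateSum = D.toLink.stateSum.re.coeff 0 := by
    show D.toLink.stateSum.re.coeff 0 + D.toLink.stateSum.im.coeff 0 = _
    rw [Link.im_stateSum]; simp
  have h2 := map_stateSum SkeinRing.evalOne SkeinRing.q SkeinRing.qi D.slices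
  have h3 : SkeinRing.evalOne SkeinRing.q = 1 := by
    show (0 : Polynomial ℤ).coeff 0 + (1 : Polynomial ℤ).coeff 0 = 1
    simp
  have h4 : SkeinRing.evalOne SkeinRing.qi = 1 := by
    show (-Polynomial.X : Polynomial ℤ).coeff 0 + (1 : Polynomial ℤ).coeff 0 = 1
    simp
  rw [h3, h4] at h2
  rw [← h1, ← h2]; rfl

end Final

/-! ### Labellings at `q = 1`, and the low coefficients for knots. -/

section Knots

/-- The labels above and below a slice are constant along the strands. -/
def Compatible (s : Slice) (σ τ : List Bool) : Prop :=
  ∃ α β γ δ : List Bool, α.length = s.left.length ∧ β.length = s.right.length ∧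
    σ = α ++ γ ++ β ∧ τ = α ++ δ ++ β ∧
    match s.event with
    | .cup _ => ∃ b, γ = [] ∧ δ = [b, b]
    | .cap _ => ∃ b, γ = [b, b] ∧ δ = []
    | .cross _ _ _ => ∃ b c, γ = [b, c] ∧ δ = [c, b]

/-- The labels are constant along the strands of the diagram. -/
def IsColoring (T : List Slice) (σ : ℕ → List Bool) : Prop :=
  ∀ k s, T[k]? = some s → Compatible s (σ k) (σ (k + 1))

theorem IsColoring.joined {T : List Slice} {σ : ℕ → List Bool} (h : IsColoring T σ) {P Q : ℕ × ℕ}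
    (hPQ : Joined T P Q) : (σ P.1)[P.2]? = (σ Q.1)[Q.2]? := by
  cases hPQ with
  | left k s i hs hi =>
    obtain ⟨α, β, γ, δ, h1, h2, h3, h4, h5⟩ := h k s hs
    simp only [h3, h4, List.append_assoc]
    rw [List.getElem?_append_left (by omega), List.getElem?_append_left (by omega)]
  | right k s i hs hi =>
    obtain ⟨l, e, r⟩ := s
    obtain ⟨α, β, γ, δ, h1, h2, h3, h4, h5⟩ := h k _ hs
    have h6 : γ.length = e.src.length ∧ δ.length = e.tgt.length := by
      rcases e with x | x | ⟨p, x, y⟩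
      · obtain ⟨b, rfl, rfl⟩ := h5; exact ⟨rfl, rfl⟩
      · obtain ⟨b, rfl, rfl⟩ := h5; exact ⟨rfl, rfl⟩
      · obtain ⟨b, c, rfl, rfl⟩ := h5; exact ⟨rfl, rfl⟩
    dsimp only at h1 h2 hi ⊢
    simp only [h3, h4]
    rw [List.getElem?_append_right (by simp; omega), List.getElem?_append_right (by simp; omega)]
    congr 1
    simp; omega
  | cup k l r x hs =>
    obtain ⟨α, β, γ, δ, h1, h2, h3, h4, b, rfl, rfl⟩ := h k _ hs
    simp only at h1
    simp [h4, ← h1]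
  | cap k l r x hs =>
    obtain ⟨α, β, γ, δ, h1, h2, h3, h4, b, rfl, rfl⟩ := h k _ hs
    simp only at h1
    simp [h3, ← h1]
  | cross_right k l r p x y hs =>
    obtain ⟨α, β, γ, δ, h1, h2, h3, h4, b, c, rfl, rfl⟩ := h k _ hs
    simp only at h1
    simp [h3, h4, ← h1]
  | cross_left k l r p x y hs =>
    obtain ⟨α, β, γ, δ, h1, h2, h3, h4, b, c, rfl, rfl⟩ := h k _ hs
    simp only at h1
    simp [h3, h4, ← h1]

theorem IsColoring.eqvGen {T : List Slice} {σ : ℕ → List Bool} (h : IsColoring T σ) {P Q : ℕ × ℕ}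
    (hPQ : Relation.EqvGen (Joined T) P Q) : (σ P.1)[P.2]? = (σ Q.1)[Q.2]? := by
  induction hPQ with
  | rel P Q hPQ => exact h.joined hPQ
  | refl P => rfl
  | symm P Q _ ih => exact ih.symm
  | trans P Q S _ _ ih ih' => exact ih.trans ih'

theorem isColoring_cons {s : Slice} {T : List Slice} {σ : ℕ → List Bool} {τ : List Bool}
    (hs : Compatible s τ (σ 0)) (h : IsColoring T σ) :
    IsColoring (s :: T) (fun | 0 => τ | k + 1 => σ k) := by
  intro k t ht
  rcases k with _ | k
  · obtain rfl : s = t := by simpa using ht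
    exact hs
  · exact h k t (by simpa using ht)

/-- At `q = 1` the turning weights vanish, so every term continues labels along the strands, and a
non-zero sum has a non-zero term. -/
theorem exists_compatible {s : Slice} {Φ : List Bool → ℤ} {σ : List Bool}
    (hσ : σ.length = s.src.length) (h : shiftOp (eventOp 1 1 s.event) s.left.length Φ σ ≠ 0) :
    ∃ τ, Compatible s σ τ ∧ τ.length = s.tgt.length ∧ Φ τ ≠ 0 := by
  obtain ⟨l, e, r⟩ := s
  obtain ⟨α, ρ, rfl, hα⟩ : ∃ α ρ, σ = α ++ ρ ∧ α.length = l.length :=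
    ⟨σ.take l.length, σ.drop l.length, (List.take_append_drop _ _).symm, by
      simp [Slice.src] at hσ ⊢; omega⟩
  simp only [Slice.src, List.length_append] at hσ
  rw [← hα] at h
  have h' := shiftOp_add (eventOp (1 : ℤ) 1 e) 0 Φ α ρ
  rw [Nat.add_zero] at h'
  rw [h'] at h
  rcases e with x | x | ⟨p, x, y⟩
  · have h2 : ∃ b, Φ (α ++ b :: b :: ρ) ≠ 0 := by
      by_contra! h2
      simp [shiftOp, eventOp, h2] at h
    obtain ⟨b, hb⟩ := h2
    refine ⟨_, ⟨α, ρ, [], [b, b], hα, ?_, by simp, rfl, b, rfl, rfl⟩, ?_, by simpa using hb⟩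
    · simp [Event.src] at hσ; simp; omega
    · simp [Slice.tgt, Event.src, Event.tgt] at hσ ⊢; omega
  · obtain ⟨b, c, ρ, rfl⟩ : ∃ b c ρ', ρ = b :: c :: ρ' := by
      rcases ρ with _ | ⟨b, _ | ⟨c, ρ⟩⟩
      · simp [Event.src] at hσ; omega
      · simp [Event.src] at hσ; omega
      · exact ⟨b, c, ρ, rfl⟩
    simp only [shiftOp, eventOp] at h
    have hbc : b = c := by
      by_contra hbc
      simp [hbc] at h
    subst hbc
    refine ⟨_, ⟨α, ρ, [b, b], [], hα, ?_, by simp, rfl, b, rfl, rfl⟩, ?_, ?_⟩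
    · simp [Event.src] at hσ; simp; omega
    · simp [Slice.tgt, Event.src, Event.tgt] at hσ ⊢; omega
    · intro h0
      simp at h0
      simp [h0] at h
  · obtain ⟨b, c, ρ, rfl⟩ : ∃ b c ρ', ρ = b :: c :: ρ' := by
      rcases ρ with _ | ⟨b, _ | ⟨c, ρ⟩⟩
      · simp [Event.src] at hσ; omega
      · simp [Event.src] at hσ; omega
      · exact ⟨b, c, ρ, rfl⟩
    have ht : turnWeight (1 : ℤ) 1 p x y b c = 0 := by
      unfold turnWeight; split_ifs <;> simp
    simp only [shiftOp, eventOp, ht, zero_mul, add_zero] at h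
    refine ⟨_, ⟨α, ρ, [b, c], [c, b], hα, ?_, by simp, rfl, b, c, rfl, rfl⟩, ?_, ?_⟩
    · simp [Event.src] at hσ; simp; omega
    · simp [Slice.tgt, Event.src, Event.tgt] at hσ ⊢; omega
    · intro h0
      simp at h0
      simp [h0] at h

theorem exists_isColoring {a : Strands} {T : List Slice} (hT : IsTangle a T []) {τ : List Bool}
    (hτ : τ.length = a.length) (h : pull (1 : ℤ) 1 T emptyLabels τ ≠ 0) :
    ∃ σ, σ 0 = τ ∧ IsColoring T σ := by
  induction T generalizing a τ with
  | nil => exact ⟨fun _ => τ, rfl, fun k s hs => by simp at hs⟩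
  | cons s T ih =>
    obtain ⟨rfl, hT⟩ := hT
    obtain ⟨ρ, h1, h2, h3⟩ := exists_compatible hτ h
    obtain ⟨σ, h4, h5⟩ := ih hT h2 h3
    exact ⟨_, rfl, isColoring_cons (h4 ▸ h1) h5⟩

theorem compatible_zero (s : Slice) : Compatible s (List.replicate s.src.length false)
    (List.replicate s.tgt.length false) := by
  obtain ⟨l, e, r⟩ := s
  refine ⟨List.replicate l.length false, List.replicate r.length false,
    List.replicate e.src.length false, List.replicate e.tgt.length false, by simp, by simp, ?_, ?_,
    ?_⟩
  · simp [Slice.src]; omega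
  · simp [Slice.tgt]; omega
  · rcases e with x | x | ⟨p, x, y⟩
    · exact ⟨false, rfl, rfl⟩
    · exact ⟨false, rfl, rfl⟩
    · exact ⟨false, false, rfl, rfl⟩

theorem exists_isColoring_append {a b : Strands} {A T : List Slice} (hA : IsTangle a A b)
    {σ : ℕ → List Bool} (h0 : σ 0 = List.replicate b.length false) (h : IsColoring T σ) :
    ∃ σ', σ' 0 = List.replicate a.length false ∧ (∀ i, σ' (A.length + i) = σ i) ∧
      IsColoring (A ++ T) σ' := by
  induction A generalizing a with
  | nil => cases hA; exact ⟨σ, h0, by simp, h⟩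
  | cons s A ih =>
    obtain ⟨rfl, hA⟩ := hA
    obtain ⟨σ', h1, h2, h3⟩ := ih hA
    refine ⟨_, rfl, fun i => ?_, isColoring_cons (h1 ▸ compatible_zero s) h3⟩
    rw [← h2 i, List.length_cons, show A.length + 1 + i = A.length + i + 1 by omega]

theorem isPoint_of_tgt {A T : List Slice} {s : Slice} {i : ℕ} (hT : IsTangle s.tgt T [])
    (hi : i < s.tgt.length) : IsPoint (A ++ s :: T) (A.length + 1, i) := by
  rcases T with _ | ⟨t, T⟩
  · have : s.tgt = [] := hT
    simp [this] at hi
  · refine ⟨t, ?_, hT.1 ▸ hi⟩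
    rw [List.getElem?_append_right (by simp)]
    simp

/-- With all labels `false` every weight is `1` at `q = 1`. Only a minimum offers another term, with
`true` on both legs; were it non-zero, there would be a labelling constant along the knot that is
`false` at the cut and `true` at this minimum. -/
theorem pull_zero_labels {x : Bool} {a : Strands} {A T : List Slice}
    (hA : IsTangle [x, !x] A a) (hT : IsTangle a T [])
    (hK : ∀ P Q, IsPoint (⟨[], .cup x, []⟩ :: (A ++ T)) P →
      IsPoint (⟨[], .cup x, []⟩ :: (A ++ T)) Q →
      Relation.EqvGen (Joined (⟨[], .cup x, []⟩ :: (A ++ T))) P Q) :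
    pull (1 : ℤ) 1 T emptyLabels (List.replicate a.length false) = 1 := by
  induction T generalizing A a with
  | nil => cases hT; rfl
  | cons s T ih =>
    have hT' := hT
    obtain ⟨rfl, hT⟩ := hT
    -- The slice passes from the upper part to the lower part `A`, so the whole diagram, about which
    -- `hK` speaks, stays the same.
    have hrec := ih (A := A ++ [s]) (hA.append ⟨rfl, rfl⟩) hT (by simpa using hK)
    have hsrc : List.replicate s.src.length false = List.replicate s.left.length false ++
        (List.replicate s.event.src.length false ++ List.replicate s.right.length false) := by
      simp [Slice.src]
    have htgt : List.replicate s.tgt.length false = List.replicate s.left.length false ++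
        (List.replicate s.event.tgt.length false ++ List.replicate s.right.length false) := by
      simp [Slice.tgt]
    have hshift := shiftOp_add (eventOp (1 : ℤ) 1 s.event) 0 (pull 1 1 T emptyLabels)
      (List.replicate s.left.length false)
      (List.replicate s.event.src.length false ++ List.replicate s.right.length false)
    rw [List.length_replicate, Nat.add_zero] at hshift
    rw [pull, hsrc, hshift, shiftOp]
    rw [htgt] at hrec
    clear hshift
    obtain ⟨l, e, r⟩ := s
    rcases e with y | y | ⟨p, y, z⟩
    · simp only [Event.src, Event.tgt, List.length_nil, List.length_cons, List.replicate_zero,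
        List.nil_append, List.replicate_succ, List.cons_append, eventOp] at hrec ⊢
      have hzero : pull (1 : ℤ) 1 T emptyLabels (List.replicate l.length false ++
          true :: true :: List.replicate r.length false) = 0 := by
        by_contra hne
        obtain ⟨σ, h1, h2⟩ := exists_isColoring hT (by simp [Slice.tgt, Event.tgt]) hne
        have hc : Compatible ⟨l, .cup y, r⟩ (List.replicate (Slice.src ⟨l, .cup y, r⟩).length false)
            (σ 0) := by
          refine ⟨List.replicate l.length false, List.replicate r.length false, [], [true, true],
            by simp, by simp, by simp [Slice.src, Event.src], by simp [h1], true, rfl, rfl⟩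
        -- The labelling of the upper part is continued downwards by `false` on all strands below
        -- the minimum.
        obtain ⟨σ', h3, h4, h5⟩ := exists_isColoring_append hA rfl (isColoring_cons hc h2)
        have h6 := isColoring_cons (s := ⟨[], .cup x, []⟩) (τ := []) (σ := σ')
          ⟨[], [], [], [false, false], rfl, rfl, rfl, by simp [h3], false, rfl, rfl⟩ h5
        have hP : IsPoint (⟨[], .cup x, []⟩ :: (A ++ ⟨l, .cup y, r⟩ :: T)) (1, 0) :=
          isPoint_of_tgt (A := []) (s := ⟨[], .cup x, []⟩)
            (show IsTangle _ _ [] from hA.append hT') (by simp [Slice.tgt, Event.tgt])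
        have hQ : IsPoint (⟨[], .cup x, []⟩ :: (A ++ ⟨l, .cup y, r⟩ :: T))
            (A.length + 2, l.length) :=
          isPoint_of_tgt (A := ⟨[], .cup x, []⟩ :: A) (s := ⟨l, .cup y, r⟩) hT
            (by simp [Slice.tgt, Event.tgt])
        have h7 := h6.eqvGen (hK _ _ hP hQ)
        have h8 := h4 1
        simp only [h3, h8, h1] at h7
        simp at h7
      rw [hzero, hrec]
      cases y <;> simp [cupWeight]
    · simp only [Event.src, Event.tgt, List.length_nil, List.length_cons, List.replicate_zero,
        List.nil_append, List.replicate_succ, List.cons_append, eventOp] at hrec ⊢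
      rw [if_pos trivial, hrec]
      cases y <;> simp [capWeight]
    · simp only [Event.src, Event.tgt, List.length_nil, List.length_cons, List.replicate_zero,
        List.nil_append, List.replicate_succ, List.cons_append, eventOp] at hrec ⊢
      have ht : turnWeight (1 : ℤ) 1 p y z false false = 0 := by
        unfold turnWeight; split_ifs <;> simp
      have hp : passWeight (1 : ℤ) 1 p y z false false = 1 := by
        unfold passWeight
        generalize (p == (y == z)) = s
        cases s <;> simp
      rw [ht, hp, hrec]
      simp

theorem LinkDiagram.IsKnotDiagram.stateSum_eq_one {D : LinkDiagram} (h : D.IsKnotDiagram) :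
    stateSum (1 : ℤ) 1 D.slices = 1 := by
  obtain ⟨T, hT, hne⟩ := D
  unfold LinkDiagram.IsKnotDiagram at h
  simp only at h ⊢
  rcases T with _ | ⟨s, T⟩
  · exact absurd rfl hne
  · obtain ⟨x, rfl⟩ := exists_eq_cup hT.1
    have := pull_zero_labels (x := x) (A := []) rfl hT.2 h
    have h2 : pull (1 : ℤ) 1 T emptyLabels [false, false] = 1 := this
    rw [stateSum, h2]
    cases x <;> simp

theorem Knot.coeff_zero (K : Knot) : K.1.stateSum.re.coeff 0 = 1 := by
  obtain ⟨L, D, hD, rfl⟩ := K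
  exact (Link.coeff_zero_stateSum D).trans hD.stateSum_eq_one

open Polynomial in
theorem Knot.coeff_one (K : Knot) : K.1.stateSum.re.coeff 1 = 0 := by
  have h := exists_isConwayPolynomial.comp_neg_X K.1
  have h0 := K.coeff_zero
  beta_reduce at h
  generalize K.1.stateSum.re = f at *
  have h1 : (f.comp (-X)).coeff 0 = f.coeff 0 := by
    simp [coeff_zero_eq_eval_zero]
  have h2 : (f.comp (-X)).coeff 1 = -f.coeff 1 := by
    have e : ∀ g : ℤ[X], g.coeff 1 = (derivative g).eval 0 := fun g => by
      rw [← coeff_zero_eq_eval_zero, coeff_derivative]; simp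
    rw [e, e, derivative_comp]
    simp
  have h3 := congrArg (fun g => coeff g 0) h
  have h4 := congrArg (fun g => coeff g 1) h
  simp only [coeff_C_mul, h1, h2, h0] at h3 h4
  -- The constant coefficient `1` forces the factor `-sign` to be `1`; the linear coefficient then
  -- equals its own negative.
  rw [mul_one] at h3
  rw [h3] at h4
  omega

theorem coeff_two_connectedSum {K₁ K₂ K : Knot} (h : IsConnectedSum K₁ K₂ K) :
    K.1.stateSum.re.coeff 2 = K₁.1.stateSum.re.coeff 2 + K₂.1.stateSum.re.coeff 2 := by
  rw [stateSum_connectedSum h, Polynomial.coeff_mul]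
  simp [Finset.Nat.antidiagonal_succ, Knot.coeff_zero, Knot.coeff_one]
  ring

theorem coeff_two_iteratedConnectedSum {Ks : List Knot} {K : Knot}
    (h : IsIteratedConnectedSum Ks K) :
    K.1.stateSum.re.coeff 2 = (Ks.map fun K' => K'.1.stateSum.re.coeff 2).sum := by
  induction h with
  | single K => simp
  | snoc Ks K K' K'' _ hK ih => rw [coeff_two_connectedSum hK, ih]; simp

end Knots

end KnotTheory

theorem mainTheorem5 :
    (∃! nabla : Link → Polynomial ℤ, IsConwayPolynomial nabla) ∧
    ∀ nabla : Link → Polynomial ℤ, IsConwayPolynomial nabla →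
      (∀ K₁ K₂ K : Knot,
        (K₁.IsPrime ∨ K₁ = Knot.unknot) → (K₂.IsPrime ∨ K₂ = Knot.unknot) →
        IsConnectedSum K₁ K₂ K →
        (nabla K.1).coeff 2 = (nabla K₁.1).coeff 2 + (nabla K₂.1).coeff 2) ∧
      (∀ (Ks : List Knot) (K : Knot),
        (∀ K' ∈ Ks, K'.IsPrime ∨ K' = Knot.unknot) →
        IsIteratedConnectedSum Ks K →
        (nabla K.1).coeff 2 = (Ks.map fun K' => (nabla K'.1).coeff 2).sum) := by
  refine ⟨⟨_, exists_isConwayPolynomial, fun f hf => hf.unique exists_isConwayPolynomial⟩, ?_⟩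
  intro nabla h
  obtain rfl := h.unique exists_isConwayPolynomial
  exact ⟨fun _ _ _ _ _ hK => coeff_two_connectedSum hK,
    fun _ _ _ hK => coeff_two_iteratedConnectedSum hK⟩
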